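/- Let $E: 0\to V\to G\to W\to 0$ be a central extension of groups in which $V$ and $W$ are $\mathbb F_2$-vector spaces, $\dim W=n<\infty$, and let $q\in H^2(W;V)$ be its extension class. Let $Q:W\to V$ be the associated quadratic map, $Q(w)=\hat w^{\,2}$ for any lift $\hat w\in G$ of $w$. For a basis $v_1,\dots,v_n$ of $V$ let $q_1,\dots,q_n\in H^2(W;\mathbb F_2)$ be the components of $q$ (the $k$-invariants), let $I(Q)=(q_1,\dots,q_n)\subseteq H^*(W;\mathbb F_2)$ (this ideal does not depend on the basis), and put $A^*(Q)=H^*(W;\mathbb F_2)/I(Q)$. Assume that $E$ is Bockstein closed, i.e. $I(Q)$ is invariant under the Bockstein operator $\beta$ of $H^*(W;\mathbb F_2)$, and $2$-power exact, i.e. (i) $\dim V=\dim W$, (ii) the image of $Q$ generates $V$, and (iii) $Q(w)=0$ if and only if $w=0$. Then, for every basis of $V$: 1. $q_1,\dots,q_n$ is a regular sequence in $H^*(W;\mathbb F_2)$, and $A^*(Q)$ is a finite-dimensional $\mathbb F_2$-vector space. 2. $q_1,\dots,q_n$ are algebraically independent over $\mathbb F_2$, i.e. the subalgebra $P=\mathbb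 F_2[q_1,\dots,q_n]$ of $H^*(W;\mathbb F_2)$ generated by them is a polynomial algebra. 3. $H^*(W;\mathbb F_2)$ is a free $P$-module, and as $P$-modules $H^*(W;\mathbb F_2)\cong P\otimes_{\mathbb F_2}A^*(Q)$, where $P$ acts on the tensor product through the left factor. -/

import Mathlib

set_option linter.unusedSectionVars false

/-- Inhomogeneous (bar) cochains of `W` with constant coefficients `R`, in all degrees at once:
the restriction of `f` to lists `[g₁, …, gₙ]` of length `n` is its component in degree `n`. -/
def BarCochain (R W : Type*) : Type _ := List W → R

namespace BarCochain

section Basic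

variable {R W : Type*} [CommRing R]

instance : AddCommGroup (BarCochain R W) := inferInstanceAs (AddCommGroup (List W → R))

instance : Module R (BarCochain R W) := inferInstanceAs (Module R (List W → R))

@[ext] theorem ext {f g : BarCochain R W} (h : ∀ l, f l = g l) : f = g := funext h

@[simp] theorem zero_apply (l : List W) : (0 : BarCochain R W) l = 0 := rfl

@[simp] theorem add_apply (f g : BarCochain R W) (l : List W) : (f + g) l = f l + g l := rfl

@[simp] theorem neg_apply (f : BarCochain R W) (l : List W) : (-f) l = -f l := rfl

@[simp] theorem sub_apply (f g : BarCochain R W) (l : List W) : (f - g) l = f l - g l := rfl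

@[simp] theorem smul_apply (r : R) (f : BarCochain R W) (l : List W) : (r • f) l = r * f l := rfl

/-- The unit cochain: `1` in degree zero. -/
instance : One (BarCochain R W) := ⟨fun l => if l.length = 0 then 1 else 0⟩

/-- The cup product:
`(f ∪ g)(g₁, …, gₙ) = ∑ₚ f(g₁, …, gₚ) g(gₚ₊₁, …, gₙ)`. -/
instance : Mul (BarCochain R W) :=
  ⟨fun f g l => ∑ i ∈ Finset.range (l.length + 1), f (l.take i) * g (l.drop i)⟩

theorem mul_apply (f g : BarCochain R W) (l : List W) :
    (f * g) l = ∑ i ∈ Finset.range (l.length + 1), f (l.take i) * g (l.drop i) := rfl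

@[simp] theorem one_nil : (1 : BarCochain R W) [] = 1 := rfl

@[simp] theorem one_cons (x : W) (l : List W) : (1 : BarCochain R W) (x :: l) = 0 := rfl

/-- The cochain `l ↦ f (x :: l)`. -/
def shift (x : W) (f : BarCochain R W) : BarCochain R W := fun l => f (x :: l)

@[simp] theorem shift_apply (x : W) (f : BarCochain R W) (l : List W) :
    shift x f l = f (x :: l) := rfl

@[simp] theorem mul_nil (f g : BarCochain R W) : (f * g) [] = f [] * g [] := by
  simp [mul_apply]

@[simp] theorem mul_cons (f g : BarCochain R W) (x : W) (l : List W) :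
    (f * g) (x :: l) = f [] * g (x :: l) + (shift x f * g) l := by
  simp only [mul_apply, List.length_cons]
  rw [Finset.sum_range_succ']
  simp [add_comm]

theorem add_mul' (f g h : BarCochain R W) (l : List W) :
    ((f + g) * h) l = (f * h) l + (g * h) l := by
  simp [mul_apply, add_mul, Finset.sum_add_distrib]

theorem mul_add' (f g h : BarCochain R W) (l : List W) :
    (f * (g + h)) l = (f * g) l + (f * h) l := by
  simp [mul_apply, mul_add, Finset.sum_add_distrib]

theorem smul_mul' (r : R) (f g : BarCochain R W) (l : List W) :
    ((r • f) * g) l = r * (f * g) l := by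
  simp [mul_apply, Finset.mul_sum, mul_assoc]

theorem mul_smul' (r : R) (f g : BarCochain R W) (l : List W) :
    (f * (r • g)) l = r * (f * g) l := by
  simp [mul_apply, Finset.mul_sum, mul_left_comm]

theorem shift_mul (x : W) (f g : BarCochain R W) :
    shift x (f * g) = f [] • shift x g + shift x f * g := by
  ext l; simp

theorem mul_assoc' (f g h : BarCochain R W) (l : List W) :
    ((f * g) * h) l = (f * (g * h)) l := by
  induction l generalizing f with
  | nil => simp [mul_assoc]
  | cons x l ih =>
    simp only [mul_cons, mul_nil, shift_mul, add_mul', smul_mul', ih]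
    ring

theorem zero_mul' (g : BarCochain R W) (l : List W) : ((0 : BarCochain R W) * g) l = 0 := by
  simp [mul_apply]

theorem one_mul' (f : BarCochain R W) (l : List W) : (1 * f) l = f l := by
  cases l with
  | nil => simp
  | cons x l =>
    have : shift x (1 : BarCochain R W) = 0 := by ext l; simp
    simp [this, zero_mul']

theorem mul_one' (f : BarCochain R W) (l : List W) : (f * 1) l = f l := by
  induction l generalizing f with
  | nil => simp
  | cons x l ih => simp [ih]

instance : Ring (BarCochain R W) :=
  { (inferInstance : AddCommGroup (BarCochain R W)) with
    mul := (· * ·)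
    one := 1
    left_distrib := fun f g h => ext (mul_add' f g h)
    right_distrib := fun f g h => ext (add_mul' f g h)
    zero_mul := fun f => ext (zero_mul' f)
    mul_zero := fun f => ext fun l => by simp [mul_apply]
    mul_assoc := fun f g h => ext (mul_assoc' f g h)
    one_mul := fun f => ext (one_mul' f)
    mul_one := fun f => ext (mul_one' f) }

instance : Algebra R (BarCochain R W) :=
  Algebra.ofModule (fun r f g => ext (smul_mul' r f g)) (fun r f g => ext (mul_smul' r f g))

/-- `f` has finite degree: it has only finitely many nonzero homogeneous components. -/
def IsBounded (f : BarCochain R W) : Prop := ∃ N : ℕ, ∀ l : List W, N ≤ l.length → f l = 0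

theorem IsBounded.add {f g : BarCochain R W} (hf : f.IsBounded) (hg : g.IsBounded) :
    (f + g).IsBounded := by
  obtain ⟨N, hN⟩ := hf
  obtain ⟨M, hM⟩ := hg
  exact ⟨N + M, fun l hl => by simp [hN l (by omega), hM l (by omega)]⟩

theorem IsBounded.smul (r : R) {f : BarCochain R W} (hf : f.IsBounded) :
    (r • f).IsBounded := by
  obtain ⟨N, hN⟩ := hf
  exact ⟨N, fun l hl => by simp [hN l hl]⟩

theorem IsBounded.mul {f g : BarCochain R W} (hf : f.IsBounded) (hg : g.IsBounded) :
    (f * g).IsBounded := by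
  obtain ⟨N, hN⟩ := hf
  obtain ⟨M, hM⟩ := hg
  refine ⟨N + M, fun l hl => ?_⟩
  rw [mul_apply]
  refine Finset.sum_eq_zero fun i hi => ?_
  rw [Finset.mem_range] at hi
  rcases le_or_gt N i with h | h
  · rw [hN (l.take i) (by simp; omega), zero_mul]
  · rw [hM (l.drop i) (by simp; omega), mul_zero]

theorem isBounded_one : (1 : BarCochain R W).IsBounded :=
  ⟨1, fun l hl => by cases l with
    | nil => simp at hl
    | cons x l => rfl⟩

theorem isBounded_zero : (0 : BarCochain R W).IsBounded := ⟨0, fun _ _ => rfl⟩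

end Basic

section Differential

variable {R W : Type*} [CommRing R] [AddCommGroup W]

/-- `mergeAt i [g₀, …, gₙ] = [g₀, …, gᵢ + gᵢ₊₁, …, gₙ]` for `i < n`. -/
def mergeAt : ℕ → List W → List W
  | 0, x :: y :: l => (x + y) :: l
  | i + 1, x :: l => x :: mergeAt i l
  | _, l => l

/-- The bar differential for trivial coefficients:
`(δ f)(g₀, …, gₙ) = f(g₁, …, gₙ) + ∑_{i < n} (-1)ⁱ⁺¹ f(g₀, …, gᵢ + gᵢ₊₁, …, gₙ)
  + (-1)ⁿ⁺¹ f(g₀, …, gₙ₋₁)`, and `δ f` vanishes in degree zero. -/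
def d (f : BarCochain R W) : BarCochain R W
  | [] => 0
  | x :: l => f l + ∑ i ∈ Finset.range l.length, (-1) ^ (i + 1) * f (mergeAt i (x :: l))
      + (-1) ^ (l.length + 1) * f ((x :: l).dropLast)

@[simp] theorem d_nil (f : BarCochain R W) : d f [] = 0 := rfl

@[simp] theorem d_singleton (f : BarCochain R W) (x : W) : d f [x] = 0 := by
  simp [d]

theorem d_cons_cons (f : BarCochain R W) (x y : W) (l : List W) :
    d f (x :: y :: l) = f (y :: l) - f ((x + y) :: l) + f (x :: l) - d (shift x f) (y :: l) := by
  simp only [d, List.length_cons, Finset.sum_range_succ', mergeAt, shift_apply,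
    List.dropLast_cons_cons, pow_succ]
  simp only [mul_neg, mul_one, neg_mul, neg_neg, Finset.sum_neg_distrib]
  ring

theorem d_add (f g : BarCochain R W) : d (f + g) = d f + d g := by
  ext l
  cases l with
  | nil => simp
  | cons x l => simp [d, mul_add, Finset.sum_add_distrib]; ring

theorem d_smul (r : R) (f : BarCochain R W) : d (r • f) = r • d f := by
  ext l
  cases l with
  | nil => simp
  | cons x l => simp [d, mul_add, Finset.mul_sum, mul_left_comm]

theorem d_zero : d (0 : BarCochain R W) = 0 := by
  simpa using d_smul (0 : R) (0 : BarCochain R W)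

theorem d_sub (f g : BarCochain R W) : d (f - g) = d f - d g := by
  rw [sub_eq_add_neg, d_add, ← neg_one_smul R g, d_smul, neg_one_smul, ← sub_eq_add_neg]

theorem length_mergeAt (i : ℕ) (l : List W) : l.length ≤ (mergeAt i l).length + 1 := by
  fun_induction mergeAt i l <;> simp_all

theorem IsBounded.d {f : BarCochain R W} (hf : f.IsBounded) : (d f).IsBounded := by
  obtain ⟨N, hN⟩ := hf
  refine ⟨N + 1, fun l hl => ?_⟩
  cases l with
  | nil => rfl
  | cons x l =>
    simp only [List.length_cons] at hl
    simp only [BarCochain.d]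
    rw [hN l (by omega), hN _ (by simp; omega), Finset.sum_eq_zero]
    · simp
    · intro i _
      rw [hN, mul_zero]
      have := length_mergeAt i (x :: l)
      simp only [List.length_cons] at this
      omega

/-- Change of coefficients. -/
def map {S : Type*} [CommRing S] (φ : R →+* S) (f : BarCochain R W) : BarCochain S W :=
  fun l => φ (f l)

@[simp] theorem map_apply {S : Type*} [CommRing S] (φ : R →+* S) (f : BarCochain R W)
    (l : List W) : map φ f l = φ (f l) := rfl

theorem d_map {S : Type*} [CommRing S] (φ : R →+* S) (f : BarCochain R W) :
    d (map φ f) = map φ (d f) := by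
  ext l
  cases l with
  | nil => simp
  | cons x l => simp [d]

/-- The cochain `y :: l ↦ f ((x + y) :: l)`. -/
def trans (x : W) (f : BarCochain R W) : BarCochain R W
  | [] => 0
  | y :: l => f ((x + y) :: l)

/-- The cochain `y :: l ↦ f (x :: l)`. -/
def subst (x : W) (f : BarCochain R W) : BarCochain R W
  | [] => 0
  | _ :: l => f (x :: l)

/-- `f` with its degree zero component removed. -/
def pos (f : BarCochain R W) : BarCochain R W
  | [] => 0
  | y :: l => f (y :: l)

@[simp] theorem trans_nil (x : W) (f : BarCochain R W) : trans x f [] = 0 := rfl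
@[simp] theorem trans_cons (x y : W) (f : BarCochain R W) (l : List W) :
    trans x f (y :: l) = f ((x + y) :: l) := rfl
@[simp] theorem subst_nil (x : W) (f : BarCochain R W) : subst x f [] = 0 := rfl
@[simp] theorem subst_cons (x y : W) (f : BarCochain R W) (l : List W) :
    subst x f (y :: l) = f (x :: l) := rfl
@[simp] theorem pos_nil (f : BarCochain R W) : pos f [] = 0 := rfl
@[simp] theorem pos_cons (y : W) (f : BarCochain R W) (l : List W) :
    pos f (y :: l) = f (y :: l) := rfl
@[simp] theorem shift_trans (x y : W) (f : BarCochain R W) :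
    shift y (trans x f) = shift (x + y) f := rfl
@[simp] theorem shift_subst (x y : W) (f : BarCochain R W) :
    shift y (subst x f) = shift x f := rfl
@[simp] theorem shift_pos (y : W) (f : BarCochain R W) : shift y (pos f) = shift y f := rfl
@[simp] theorem shift_add (x : W) (f g : BarCochain R W) :
    shift x (f + g) = shift x f + shift x g := rfl

theorem shift_d (x : W) (f : BarCochain R W) :
    shift x (d f) = pos f - trans x f + subst x f - d (shift x f) := by
  ext l
  cases l with
  | nil => simp
  | cons y l => simp [d_cons_cons]

theorem d_d (f : BarCochain R W) (l : List W) : d (d f) l = 0 := by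
  induction l generalizing f with
  | nil => rfl
  | cons x l ih =>
    cases l with
    | nil => simp
    | cons y l =>
      rw [d_cons_cons, shift_d, d_sub, sub_apply, ih (shift x f), d_add, d_sub]
      cases l with
      | nil => simp
      | cons z l =>
        simp only [add_apply, sub_apply, d_cons_cons, pos_cons, trans_cons, subst_cons,
          shift_trans, shift_subst, shift_pos, add_assoc]
        ring

end Differential

section ModTwo

variable {W : Type*} [AddCommGroup W]

theorem d_cons_cons_two (f : BarCochain (ZMod 2) W) (x y : W) (l : List W) :
    d f (x :: y :: l) = f (y :: l) + f ((x + y) :: l) + f (x :: l) + d (shift x f) (y :: l) := by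
  rw [d_cons_cons, CharTwo.sub_eq_add, CharTwo.sub_eq_add]

theorem shift_d_two (x : W) (f : BarCochain (ZMod 2) W) :
    shift x (d f) = pos f + trans x f + subst x f + d (shift x f) := by
  ext l
  cases l with
  | nil => simp
  | cons y l => simp [d_cons_cons_two]

theorem d_mul (f g : BarCochain (ZMod 2) W) : d (f * g) = d f * g + f * d g := by
  ext l
  induction l generalizing f with
  | nil => simp
  | cons x l ih =>
    cases l with
    | nil => simp
    | cons y l =>
      simp only [d_cons_cons_two, mul_cons, shift_mul, d_add, d_smul, add_apply, smul_apply,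
        ih (shift x f), d_nil, shift_d_two, shift_trans, shift_subst, shift_pos, shift_add,
        add_mul, pos_nil, trans_nil, subst_nil]
      clear ih
      grind

/-- Auxiliary sum `∑ f ((s + g₁ + … + gₚ) :: [gₚ₊₁, …, gₙ]) g(g₁, …, gₚ)` over `p`. -/
def cupOneAux (f : BarCochain (ZMod 2) W) :
    W → BarCochain (ZMod 2) W → BarCochain (ZMod 2) W
  | s, g, [] => f [s] * g []
  | s, g, x :: l => g [] * f (s :: x :: l) + cupOneAux f (s + x) (shift x g) l

theorem cupOneAux_add_left (f f' g : BarCochain (ZMod 2) W) (s : W) (l : List W) :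
    cupOneAux (f + f') s g l = cupOneAux f s g l + cupOneAux f' s g l := by
  induction l generalizing s g with
  | nil => simp [cupOneAux, add_mul]
  | cons x l ih => simp only [cupOneAux, ih, add_apply]; ring

theorem cupOneAux_add_right (f g g' : BarCochain (ZMod 2) W) (s : W) (l : List W) :
    cupOneAux f s (g + g') l = cupOneAux f s g l + cupOneAux f s g' l := by
  induction l generalizing s g g' with
  | nil => simp [cupOneAux, mul_add]
  | cons x l ih => simp only [cupOneAux, shift_add, ih, add_apply]; ring

theorem cupOneAux_pos (f g : BarCochain (ZMod 2) W) (s : W) (l : List W) :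
    cupOneAux (pos f) s g l = cupOneAux f s g l := by
  induction l generalizing s g with
  | nil => simp [cupOneAux]
  | cons x l ih => simp [cupOneAux, ih]

theorem cupOneAux_trans (f g : BarCochain (ZMod 2) W) (s x : W) (l : List W) :
    cupOneAux (trans x f) s g l = cupOneAux f (x + s) g l := by
  induction l generalizing s g with
  | nil => simp [cupOneAux]
  | cons y l ih => simp [cupOneAux, ih, add_assoc]

theorem cupOneAux_subst (f g : BarCochain (ZMod 2) W) (s x : W) (l : List W) :
    cupOneAux (subst x f) s g l = (g * shift x f) l := by
  induction l generalizing s g with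
  | nil => simp [cupOneAux, mul_comm]
  | cons y l ih => simp [cupOneAux, ih]

theorem cupOneAux_pos_right (f g : BarCochain (ZMod 2) W) (s y : W) (l : List W) :
    cupOneAux f s (pos g) (y :: l) = cupOneAux f (s + y) (shift y g) l := by
  simp [cupOneAux]

theorem cupOneAux_trans_right (f g : BarCochain (ZMod 2) W) (s x y : W) (l : List W) :
    cupOneAux f s (trans x g) (y :: l) = cupOneAux f (s + y) (shift (x + y) g) l := by
  simp [cupOneAux]

theorem cupOneAux_subst_right (f g : BarCochain (ZMod 2) W) (s x y : W) (l : List W) :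
    cupOneAux f s (subst x g) (y :: l) = cupOneAux f (s + y) (shift x g) l := by
  simp [cupOneAux]

theorem shift_cupOneAux (f g : BarCochain (ZMod 2) W) (s x : W) :
    shift x (cupOneAux f s g) =
      g [] • shift x (shift s f) + cupOneAux f (s + x) (shift x g) := rfl

theorem d_cupOneAux (f g : BarCochain (ZMod 2) W) (s x : W) (l : List W) :
    d (cupOneAux f s g) (x :: l) + cupOneAux (d f) s g (x :: l)
        + cupOneAux f s (d g) (x :: l) =
      cupOneAux f s g l + cupOneAux f (s + x) g l + (g * f) (x :: l) + f [] * g (x :: l) := by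
  induction l generalizing s x g with
  | nil =>
    simp [cupOneAux, d_cons_cons_two]
    grind
  | cons y l ih =>
    have h := ih (shift x g) (s + x) y
    have h1 : cupOneAux f s (d g) (x :: y :: l) =
        cupOneAux f (s + x) (shift x (d g)) (y :: l) := by
      simp [cupOneAux]
    have h2 : cupOneAux (d f) s g (x :: y :: l) = g [] * d f (s :: x :: y :: l)
        + cupOneAux (d f) (s + x) (shift x g) (y :: l) := rfl
    rw [h1, h2, d_cons_cons_two, shift_cupOneAux, d_add, add_apply, d_smul, smul_apply,
      shift_d_two, cupOneAux_add_right, cupOneAux_add_right, cupOneAux_add_right,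
      cupOneAux_pos_right, cupOneAux_trans_right, cupOneAux_subst_right,
      d_cons_cons_two f s x, d_cons_cons_two (shift s f) x y]
    rw [mul_cons, mul_cons]
    rw [mul_cons] at h
    simp only [cupOneAux, shift_apply, add_assoc] at h ⊢
    clear ih
    grind

/-- Steenrod's cup-one product. -/
def cupOne (g : BarCochain (ZMod 2) W) : BarCochain (ZMod 2) W → BarCochain (ZMod 2) W
  | f, [] => cupOneAux f 0 g []
  | f, x :: l => cupOneAux f 0 g (x :: l) + cupOne g (shift x f) l

theorem cupOne_add (f f' g : BarCochain (ZMod 2) W) (l : List W) :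
    cupOne g (f + f') l = cupOne g f l + cupOne g f' l := by
  induction l generalizing f f' with
  | nil => simp [cupOne, cupOneAux_add_left]
  | cons x l ih => simp only [cupOne, cupOneAux_add_left, shift_add, ih]; ring

theorem shift_cupOne (f g : BarCochain (ZMod 2) W) (x : W) :
    shift x (cupOne g f) =
      shift x (cupOneAux f 0 g) +
        cupOne g (shift x f) := rfl

theorem d_cupOne (f g : BarCochain (ZMod 2) W) (l : List W) :
    d (cupOne g f) l + cupOne g (d f) l + cupOne (d g) f l =
      (f * g) l + (g * f) l := by
  induction l generalizing f with
  | nil =>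
    simp [cupOne, cupOneAux]
    grind
  | cons x l ih =>
    have hS := d_cupOneAux f g 0 x l
    cases l with
    | nil =>
      simp [cupOne, cupOneAux, d_cons_cons_two] at hS ⊢
      clear ih
      grind
    | cons y l =>
      have h := ih (shift x f)
      have e1 : cupOne g (d f) (x :: y :: l) = cupOneAux (d f) 0 g (x :: y :: l)
        + cupOne g (shift x (d f)) (y :: l) := rfl
      have e2 : cupOne (d g) f (x :: y :: l) = cupOneAux f 0 (d g) (x :: y :: l)
        + cupOne (d g) (shift x f) (y :: l) := rfl
      have e3 : cupOne g (pos f) (y :: l) = cupOneAux f 0 g (y :: l) + cupOne g (shift y f) l := by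
        simp only [cupOne, cupOneAux_pos, shift_pos]
      have e4 : cupOne g (trans x f) (y :: l) =
          cupOneAux f x g (y :: l) + cupOne g (shift (x + y) f) l := by
        simp only [cupOne, cupOneAux_trans, shift_trans, add_zero]
      have e5 : cupOne g (subst x f) (y :: l) =
          (g * shift x f) (y :: l) + cupOne g (shift x f) l := by
        simp only [cupOne, cupOneAux_subst, shift_subst]
      rw [e1, e2, shift_d_two, cupOne_add, cupOne_add, cupOne_add, e3, e4, e5,
        d_cons_cons_two, shift_cupOne, d_add, add_apply]
      rw [d_cons_cons_two, zero_add] at hS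
      rw [mul_cons f g x, mul_cons g f x]
      rw [mul_cons g f x] at hS
      have e6 (z : W) (l : List W) : cupOne g f (z :: l) =
        cupOneAux f 0 g (z :: l) + cupOne g (shift z f) l := rfl
      rw [e6, e6, e6]
      clear ih
      clear e1 e2 e3 e4 e5 e6
      grind

theorem cupOneAux_eq_zero (f g : BarCochain (ZMod 2) W) (s : W) (l : List W)
    (h : ∀ b c t, b ++ c = l → f (t :: c) * g b = 0) : cupOneAux f s g l = 0 := by
  induction l generalizing s g with
  | nil => exact h [] [] s rfl
  | cons x l ih =>
    simp only [cupOneAux]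
    rw [mul_comm, h [] (x :: l) s rfl, zero_add]
    exact ih _ _ fun b c t hbc => h (x :: b) c t (by simp [hbc])

theorem cupOne_eq_zero (f g : BarCochain (ZMod 2) W) (l : List W)
    (h : ∀ a b c t, a ++ b ++ c = l → f (a ++ t :: c) * g b = 0) : cupOne g f l = 0 := by
  induction l generalizing f with
  | nil => exact cupOneAux_eq_zero f g 0 [] fun b c t hbc => h [] b c t hbc
  | cons x l ih =>
    simp only [cupOne]
    rw [cupOneAux_eq_zero f g 0 (x :: l) fun b c t hbc => h [] b c t hbc, zero_add]
    exact ih _ fun a b c t habc => h (x :: a) b c t (by simpa using habc)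

theorem IsBounded.cupOne {f g : BarCochain (ZMod 2) W} (hf : f.IsBounded) (hg : g.IsBounded) :
    (cupOne g f).IsBounded := by
  obtain ⟨N, hN⟩ := hf
  obtain ⟨M, hM⟩ := hg
  refine ⟨N + M, fun l hl => cupOne_eq_zero f g l fun a b c t h => ?_⟩
  have hlen := congrArg List.length h
  simp only [List.length_append] at hlen
  rcases le_or_gt M b.length with h1 | h1
  · rw [hM b h1, mul_zero]
  · rw [hN _ (by simp; omega), zero_mul]

/-- The integral cochain lifting `f` with values in `{0, 1}`. -/
def lift (f : BarCochain (ZMod 2) W) : BarCochain ℤ W := fun l => ((f l).val : ℤ)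

/-- The Bockstein on cochains: lift `f` to an integral cochain, apply the differential, divide by
two, reduce modulo two. -/
def bock (f : BarCochain (ZMod 2) W) : BarCochain (ZMod 2) W :=
  fun l => ((d (lift f) l / 2 : ℤ) : ZMod 2)

theorem map_lift (f : BarCochain (ZMod 2) W) : map (Int.castRingHom (ZMod 2)) (lift f) = f := by
  ext l
  simp [lift]

theorem IsBounded.lift {f : BarCochain (ZMod 2) W} (hf : f.IsBounded) :
    (lift f).IsBounded := by
  obtain ⟨N, hN⟩ := hf
  exact ⟨N, fun l hl => by simp [BarCochain.lift, hN l hl]⟩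

theorem IsBounded.map {R S : Type*} [CommRing R] [CommRing S] (φ : R →+* S) {f : BarCochain R W}
    (hf : f.IsBounded) : (map φ f).IsBounded := by
  obtain ⟨N, hN⟩ := hf
  exact ⟨N, fun l hl => by simp [hN l hl]⟩

theorem IsBounded.bock {f : BarCochain (ZMod 2) W} (hf : f.IsBounded) :
    (bock f).IsBounded := by
  obtain ⟨N, hN⟩ := hf.lift.d
  exact ⟨N, fun l hl => by simp [BarCochain.bock, hN l hl]⟩

/-- An integral cochain that vanishes modulo two is divisible by two. -/
theorem exists_eq_add_self {u : BarCochain ℤ W} (hu : u.IsBounded)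
    (h : map (Int.castRingHom (ZMod 2)) u = 0) :
    ∃ w : BarCochain ℤ W, w.IsBounded ∧ u = w + w := by
  obtain ⟨N, hN⟩ := hu
  refine ⟨fun l => u l / 2, ⟨N, fun l hl => by simp [hN l hl]⟩, ?_⟩
  refine ext fun l => ?_
  have hl : ((u l : ℤ) : ZMod 2) = 0 := congrFun h l
  have := (ZMod.intCast_zmod_eq_zero_iff_dvd (u l) 2).1 hl
  change u l = u l / 2 + u l / 2
  omega

theorem map_add_self (w : BarCochain ℤ W) :
    map (Int.castRingHom (ZMod 2)) (w + w) = 0 := by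
  ext l
  simp [CharTwo.add_self_eq_zero]

/-- The Bockstein may be computed, up to a coboundary, from any integral lift. -/
theorem bock_eq {z : BarCochain (ZMod 2) W} (hz : z.IsBounded) {u c : BarCochain ℤ W}
    (hu : u.IsBounded) (huz : map (Int.castRingHom (ZMod 2)) u = z) (hc : d u = c + c) :
    ∃ w : BarCochain (ZMod 2) W, w.IsBounded ∧
      bock z = map (Int.castRingHom (ZMod 2)) c + d w := by
  have hsub : (lift z - u).IsBounded := by
    rw [sub_eq_add_neg, ← neg_one_smul ℤ u]
    exact hz.lift.add (hu.smul _)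
  have h0 : map (Int.castRingHom (ZMod 2)) (lift z - u) = 0 := by
    ext l
    have h1 : ((lift z l : ℤ) : ZMod 2) = z l := congrFun (map_lift z) l
    have h2 : ((u l : ℤ) : ZMod 2) = z l := congrFun huz l
    simp [h1, h2]
  obtain ⟨w, hw, hwu⟩ := exists_eq_add_self hsub h0
  refine ⟨map (Int.castRingHom (ZMod 2)) w, hw.map _, ?_⟩
  rw [d_map]
  have h3 : d (lift z) = (c + d w) + (c + d w) := by
    have h5 : d (lift z) - d u = d w + d w := by rw [← d_sub, hwu, d_add]
    rw [sub_eq_iff_eq_add.1 h5, hc]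
    abel
  ext l
  have h4 : d (lift z) l = 2 * (c l + d w l) := by rw [h3, two_mul]; rfl
  simp [bock, h4]

theorem exists_d_lift {z : BarCochain (ZMod 2) W} (hz : z.IsBounded) (hd : d z = 0) :
    ∃ c : BarCochain ℤ W, c.IsBounded ∧ d (lift z) = c + c := by
  refine exists_eq_add_self hz.lift.d ?_
  rw [← d_map, map_lift, hd]

theorem d_bock {z : BarCochain (ZMod 2) W} (hz : z.IsBounded) (hd : d z = 0) :
    d (bock z) = 0 := by
  obtain ⟨c, -, hc⟩ := exists_d_lift hz hd
  have h1 : bock z = map (Int.castRingHom (ZMod 2)) c := by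
    ext l
    have h4 : d (lift z) l = 2 * c l := by rw [hc, two_mul]; rfl
    simp [bock, h4]
  have h2 : d c = 0 := by
    ext l
    have h : d c l + d c l = 0 := by
      rw [← add_apply, ← d_add, ← hc, d_d]
    simpa using h
  rw [h1, d_map, h2]
  ext l
  simp

end ModTwo

end BarCochain

section Cohomology

open BarCochain

variable (W : Type*) [AddCommGroup W]

/-- The algebra `⨁ₙ Zⁿ(W; 𝔽₂)` of cocycles. -/
def cocycleAlgebra : Subalgebra (ZMod 2) (BarCochain (ZMod 2) W) where
  carrier := {f | f.IsBounded ∧ d f = 0}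
  mul_mem' := fun {f g} hf hg => ⟨hf.1.mul hg.1, by rw [d_mul, hf.2, hg.2, zero_mul, mul_zero,
    add_zero]⟩
  add_mem' := fun {f g} hf hg => ⟨hf.1.add hg.1, by rw [d_add, hf.2, hg.2, add_zero]⟩
  algebraMap_mem' := fun r => by
    rw [Algebra.algebraMap_eq_smul_one]
    refine ⟨isBounded_one.smul r, ?_⟩
    have h : d (1 : BarCochain (ZMod 2) W) = 0 := by
      have := d_mul (1 : BarCochain (ZMod 2) W) 1
      simpa using this
    rw [d_smul, h, smul_zero]

/-- The ideal `⨁ₙ Bⁿ(W; 𝔽₂)` of coboundaries in the algebra of cocycles. -/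
def coboundaryIdeal : Ideal (cocycleAlgebra W) where
  carrier := {z | ∃ u : BarCochain (ZMod 2) W, u.IsBounded ∧ d u = z}
  add_mem' := by
    rintro _ _ ⟨u, hu, huz⟩ ⟨v, hv, hvz⟩
    exact ⟨u + v, hu.add hv, by rw [d_add, huz, hvz]; rfl⟩
  zero_mem' := ⟨0, isBounded_zero, d_zero⟩
  smul_mem' := by
    rintro c z ⟨u, hu, huz⟩
    exact ⟨c * u, c.2.1.mul hu, by rw [d_mul, c.2.2, zero_mul, zero_add, huz]; rfl⟩

instance : (coboundaryIdeal W).IsTwoSided where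
  mul_mem_of_left := by
    rintro z c ⟨u, hu, huz⟩
    exact ⟨u * c, hu.mul c.2.1, by rw [d_mul, c.2.2, mul_zero, add_zero, huz]; rfl⟩

/-- The mod two cohomology algebra `H^*(W; 𝔽₂) = ⨁ₙ Hⁿ(W; 𝔽₂)` of the group `W`, with the cup
product. -/
def ModTwoCohomology : Type _ := cocycleAlgebra W ⧸ coboundaryIdeal W

namespace ModTwoCohomology

variable {W}

/-- The cohomology class of a cocycle. -/
def mk (z : cocycleAlgebra W) : ModTwoCohomology W := Ideal.Quotient.mk (coboundaryIdeal W) z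

instance : Ring (ModTwoCohomology W) :=
  inferInstanceAs (Ring (cocycleAlgebra W ⧸ coboundaryIdeal W))

theorem mk_eq_mk {z z' : cocycleAlgebra W} :
    mk z = mk z' ↔ ∃ u : BarCochain (ZMod 2) W, u.IsBounded ∧
      d u = (z : BarCochain (ZMod 2) W) - z' :=
  Ideal.Quotient.eq

instance : CommRing (ModTwoCohomology W) where
  mul_comm := by
    rintro ⟨f, hf, hdf⟩ ⟨g, hg, hdg⟩
    refine mk_eq_mk (z := ⟨f, hf, hdf⟩ * ⟨g, hg, hdg⟩) (z' := ⟨g, hg, hdg⟩ * ⟨f, hf, hdf⟩)|>.2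
      ⟨cupOne g f, hf.cupOne hg, ?_⟩
    ext l
    have h := d_cupOne f g l
    have h0 : cupOne g (0 : BarCochain (ZMod 2) W) l = 0 :=
      cupOne_eq_zero _ _ _ fun _ _ _ _ _ => zero_mul _
    have h1 : cupOne (0 : BarCochain (ZMod 2) W) f l = 0 :=
      cupOne_eq_zero _ _ _ fun _ _ _ _ _ => mul_zero _
    rw [hdf, hdg, h0, h1, add_zero, add_zero] at h
    rw [h, ← CharTwo.sub_eq_add]
    rfl

instance : Algebra (ZMod 2) (ModTwoCohomology W) :=
  inferInstanceAs (Algebra (ZMod 2) (cocycleAlgebra W ⧸ coboundaryIdeal W))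

/-- The Bockstein operator `β : H^*(W; 𝔽₂) → H^*(W; 𝔽₂)`, raising degrees by one: the connecting
homomorphism of `0 → ℤ/2 → ℤ/4 → ℤ/2 → 0`. -/
def bockstein : ModTwoCohomology W →+ ModTwoCohomology W :=
  QuotientAddGroup.lift (coboundaryIdeal W).toAddSubgroup
    (AddMonoidHom.mk' (fun z => mk ⟨bock z, z.2.1.bock, d_bock z.2.1 z.2.2⟩) (by
      rintro ⟨f, hf, hdf⟩ ⟨g, hg, hdg⟩
      obtain ⟨a, ha, hfa⟩ := exists_d_lift hf hdf
      obtain ⟨b, hb, hgb⟩ := exists_d_lift hg hdg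
      obtain ⟨w, hw, h⟩ := bock_eq (hf.add hg) (hf.lift.add hg.lift) (c := a + b)
        (by ext l; simp [lift]) (by rw [d_add, hfa, hgb]; abel)
      refine mk_eq_mk (z' := ⟨bock f, hf.bock, d_bock hf hdf⟩ + ⟨bock g, hg.bock, d_bock hg hdg⟩)
        |>.2 ⟨w, hw, ?_⟩
      ext l
      have h1 : bock (f + g) l = _ := congrFun h l
      have h2 : d (lift f) l = 2 * a l := by rw [hfa, two_mul]; rfl
      have h3 : d (lift g) l = 2 * b l := by rw [hgb, two_mul]; rfl
      change d w l = bock (f + g) l - (bock f l + bock g l)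
      rw [h1]
      simp [bock, h2, h3]))
    (by
      rintro ⟨_, hz⟩ ⟨u, hu, rfl⟩
      obtain ⟨w, hw, h⟩ := bock_eq hu.d hu.lift.d (c := 0) (by rw [← d_map, map_lift])
        (by ext l; simp [d_d])
      refine mk_eq_mk (z' := 0) |>.2 ⟨w, hw, ?_⟩
      ext l
      have h1 : bock (d u) l = _ := congrFun h l
      change d w l = bock (d u) l - 0
      rw [h1]
      simp)

end ModTwoCohomology

end Cohomology

/-- A central extension `0 → V → G → W → 0`, with `V` and `W` written additively. -/
structure CentralExtension (V G W : Type*) [AddCommGroup V] [Group G] [AddCommGroup W] extends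
    GroupExtension (Multiplicative V) G (Multiplicative W) where
  /-- The image of `V` is central in `G`. -/
  central : ∀ (v : Multiplicative V) (g : G), inl v * g = g * inl v

namespace CentralExtension

section FactorSet

variable {V G W : Type*} [AddCommGroup V] [Group G] [AddCommGroup W] (E : CentralExtension V G W)

/-- A set-theoretic section of `G → W`. -/
noncomputable def sect (w : W) : G :=
  Function.surjInv E.rightHom_surjective (Multiplicative.ofAdd w)

theorem rightHom_sect (w : W) : E.rightHom (E.sect w) = Multiplicative.ofAdd w :=
  Function.surjInv_eq E.rightHom_surjective _

theorem exists_inl {g : G} (hg : E.rightHom g = 1) :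
    ∃ v : V, E.inl (Multiplicative.ofAdd v) = g := by
  have h : g ∈ E.inl.range := by
    rw [E.range_inl_eq_ker_rightHom]
    exact hg
  obtain ⟨v, hv⟩ := h
  exact ⟨v.toAdd, hv⟩

theorem exists_factorSet (w w' : W) : ∃ v : V,
    E.inl (Multiplicative.ofAdd v) = E.sect w * E.sect w' * (E.sect (w + w'))⁻¹ :=
  E.exists_inl (by simp [rightHom_sect])

/-- The factor set `f : W × W → V` with `s(w) s(w') = f(w, w') s(w + w')` for the section `s`. -/
noncomputable def factorSet (w w' : W) : V := (E.exists_factorSet w w').choose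

theorem factorSet_spec (w w' : W) :
    E.inl (Multiplicative.ofAdd (E.factorSet w w')) * E.sect (w + w') = E.sect w * E.sect w' := by
  rw [factorSet, (E.exists_factorSet w w').choose_spec, inv_mul_cancel_right]

theorem factorSet_cocycle (x y z : W) :
    E.factorSet x y + E.factorSet (x + y) z = E.factorSet y z + E.factorSet x (y + z) := by
  apply Multiplicative.ofAdd.injective
  apply E.inl_injective
  rw [ofAdd_add, ofAdd_add, map_mul, map_mul]
  apply mul_right_cancel (b := E.sect (x + y + z))
  rw [mul_assoc, factorSet_spec, ← mul_assoc, factorSet_spec, add_assoc x y z, mul_assoc,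
    mul_assoc, factorSet_spec, ← mul_assoc, E.central, mul_assoc, mul_assoc, ← E.central,
    factorSet_spec]

end FactorSet

variable {V G W : Type*} [AddCommGroup V] [Module (ZMod 2) V] [Group G]
  [AddCommGroup W] (E : CentralExtension V G W)

open BarCochain

/-- The 2-cochain `(w, w') ↦ φ (f(w, w'))`, where `f` is the factor set. -/
noncomputable def factorCochain (φ : Module.Dual (ZMod 2) V) : BarCochain (ZMod 2) W
  | [w, w'] => φ (E.factorSet w w')
  | _ => 0

theorem factorCochain_of_length_ne (φ : Module.Dual (ZMod 2) V) {l : List W}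
    (hl : l.length ≠ 2) : E.factorCochain φ l = 0 := by
  match l with
  | [] => rfl
  | [_] => rfl
  | [_, _] => exact absurd rfl hl
  | _ :: _ :: _ :: _ => rfl

theorem factorCochain_mem (φ : Module.Dual (ZMod 2) V) :
    E.factorCochain φ ∈ cocycleAlgebra W := by
  refine ⟨⟨3, fun l hl => E.factorCochain_of_length_ne φ (by omega)⟩, ?_⟩
  ext l
  match l with
  | [] => rfl
  | [_] => simp
  | [x, y] => simp [d_cons_cons, factorCochain]
  | [x, y, z] =>
    have h := congrArg φ (E.factorSet_cocycle x y z)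
    simp only [map_add] at h
    simp only [d_cons_cons_two, factorCochain, shift_apply, d_singleton, BarCochain.zero_apply]
    grind
  | x :: y :: z :: t :: l =>
    simp only [d_cons_cons_two, factorCochain, shift_apply, add_zero, zero_add, BarCochain.zero_apply]
    have : shift z (shift y (shift x (E.factorCochain φ))) = 0 := rfl
    rw [this, d_zero]
    cases l <;> rfl

/-- For a linear functional `φ : V → 𝔽₂`, the image `φ_*(q) ∈ H²(W; 𝔽₂)` of the extension class
`q ∈ H²(W; V)`. -/
noncomputable def component : Module.Dual (ZMod 2) V →ₗ[ZMod 2] ModTwoCohomology W :=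
  AddMonoidHom.toZModLinearMap 2 (AddMonoidHom.mk'
    (fun φ => ModTwoCohomology.mk ⟨E.factorCochain φ, E.factorCochain_mem φ⟩) (by
      intro φ ψ
      refine congrArg ModTwoCohomology.mk (Subtype.ext (ext fun l => ?_))
      change E.factorCochain (φ + ψ) l = E.factorCochain φ l + E.factorCochain ψ l
      match l with
      | [] => rfl
      | [_] => rfl
      | [_, _] => rfl
      | _ :: _ :: _ :: _ => rfl))

/-- The `k`-invariants `qᵢ ∈ H²(W; 𝔽₂)` of the extension: the components of the extension class
with respect to a basis of `V`. -/
noncomputable def kInvariant {ι : Type*} (b : Module.Basis ι (ZMod 2) V) (i : ι) :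
    ModTwoCohomology W :=
  E.component (b.coord i)

/-- The ideal `I(Q)` of `H^*(W; 𝔽₂)` generated by the components of the extension class. -/
noncomputable def extensionIdeal : Ideal (ModTwoCohomology W) :=
  Ideal.span (Set.range E.component)

/-- For every basis of `V`, the ideal `I(Q)` is generated by the `k`-invariants. -/
theorem extensionIdeal_eq_span {ι : Type*} [Finite ι] (b : Module.Basis ι (ZMod 2) V) :
    E.extensionIdeal = Ideal.span (Set.range (E.kInvariant b)) := by
  cases nonempty_fintype ι
  apply le_antisymm
  · refine Ideal.span_le.2 ?_
    rintro _ ⟨φ, rfl⟩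
    classical
    have h : φ = ∑ i, φ (b i) • b.coord i := by
      refine b.ext fun j => ?_
      simp
    rw [h, map_sum]
    refine Ideal.sum_mem _ fun i _ => ?_
    rw [map_smul]
    exact Submodule.smul_of_tower_mem _ _ (Ideal.subset_span ⟨i, rfl⟩)
  · refine Ideal.span_mono ?_
    rintro _ ⟨i, rfl⟩
    exact ⟨b.coord i, rfl⟩

/-- `E` is Bockstein closed: `I(Q)` is invariant under the Bockstein operator. -/
def IsBocksteinClosed : Prop :=
  ∀ x ∈ E.extensionIdeal, ModTwoCohomology.bockstein x ∈ E.extensionIdeal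

/-- The algebra `A^*(Q) = H^*(W; 𝔽₂) / (q₁, …, qₙ)`. -/
abbrev QuotientAlgebra : Type _ := ModTwoCohomology W ⧸ E.extensionIdeal

variable [Module (ZMod 2) W]

theorem exists_square (w : W) : ∃ v : V, ∀ g : G, E.rightHom g = Multiplicative.ofAdd w →
    E.inl (Multiplicative.ofAdd v) = g ^ 2 := by
  obtain ⟨v, hv⟩ := E.exists_inl (g := E.sect w ^ 2) (by
    rw [map_pow, rightHom_sect, ← ofAdd_nsmul, two_nsmul, ZModModule.add_self, ofAdd_zero])
  refine ⟨v, fun g hg => ?_⟩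
  obtain ⟨u, hu⟩ := E.exists_inl (g := g * (E.sect w)⁻¹) (by
    rw [map_mul, map_inv, rightHom_sect, hg, mul_inv_cancel])
  have hg' : g = E.inl (Multiplicative.ofAdd u) * E.sect w := by rw [hu, inv_mul_cancel_right]
  have hu2 : E.inl (Multiplicative.ofAdd u) ^ 2 = 1 := by
    rw [← map_pow, ← ofAdd_nsmul, two_nsmul, ZModModule.add_self, ofAdd_zero, map_one]
  rw [hv, hg', (show Commute _ _ from E.central _ _).mul_pow, hu2, one_mul]

/-- The quadratic map `Q : W → V` of the extension: `Q(w) = ŵ²` for any lift `ŵ ∈ G` of `w`. -/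
noncomputable def quadraticMap (w : W) : V := (E.exists_square w).choose

/-- `E` is 2-power exact: `dim V = dim W`, the image of `Q` generates `V`, and `Q(w) = 0` only
for `w = 0`. -/
structure IsTwoPowerExact : Prop where
  finrank_eq : Module.finrank (ZMod 2) V = Module.finrank (ZMod 2) W
  span_eq_top : Submodule.span (ZMod 2) (Set.range E.quadraticMap) = ⊤
  eq_zero_iff : ∀ w : W, E.quadraticMap w = 0 ↔ w = 0

end CentralExtension

/-!
Choose a basis of `W`. The cohomology algebra `H^*(W; 𝔽₂)` is the polynomial algebra
`S = 𝔽₂[X₁, …, Xₙ]` on the classes of the dual basis, and under this identification the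
`k`-invariants are quadratic forms `p₁, …, pₙ`, which together evaluate to the quadratic map `Q` on
`W = 𝔽₂ⁿ`. The point of the proof is that `p₁, …, pₙ` is a homogeneous system of parameters of `S`;
the rest is commutative algebra.

*The polynomial algebra.* Write `W = W' ⊕ ⟨e⟩` with `W'` the kernel of a functional `x`. A prism
operator on bar cochains (`d_prism`) shows that a cocycle of the cone of `x ∪ ·` vanishing on `W'`
is a coboundary (`exists_primitive_of_cone`). Hence the class of `x` is a nonzerodivisor which
generates the kernel of the split surjection `H^*(W) → H^*(W')`, and induction on the dimension
gives `isPolynomialOn_coord`. The `k`-invariants are identified in `exists_component_eq`, and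
`bockstein_quadPoly` computes the Bockstein: on quadratic forms it is the
derivation with `Xⱼ ↦ Xⱼ²`.

*The zero locus.* Let `u` be a common zero of the `pᵢ` in a finite field `L` of characteristic two,
and let `F` be the Frobenius map on `Lⁿ`. Bockstein closedness says that the polar forms
`Bᵢ(u, F u)` vanish, so `u + F u` is again a common zero. Comparing `u` with `u + F u` gives
`Bᵢ(u, Fᵏ u) = 0` for all `k` by induction, so the `pᵢ` vanish on the `L`-span of the conjugates of
`u`. This span contains the vectors of traces `(Tr (b uⱼ))ⱼ`, which are `𝔽₂`-rational common zeros,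
that is, zeros of `Q`. They vanish since `Q(w) = 0` only for `w = 0`, and the trace form is
nondegenerate, so `u = 0`. By the Nullstellensatz the radical of `(p₁, …, pₙ)` contains all `Xⱼ`
(`X_mem_radical_span_quadPoly`).

*Regularity and freeness.* In the localization of `S` at the origin, `X₁, …, Xₙ` is a regular
sequence, hence so is every other system of `n` parameters (`isWeaklyRegular_of_supportDim_nonpos`);
homogeneity carries this back to `S` (`isRegular_of_X_mem_radical`). Take monomials that form a
basis of `S / (p₁, …, pₙ)`. They stay linearly independent over the polynomials in a regular
sequence (`linearIndependent_prod_pow_smul`), and they generate `S` over `𝔽₂[p₁, …, pₙ]` by the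
graded Nakayama argument (`span_prod_pow_mul_eq_top`). This gives algebraic independence, freeness
and the tensor decomposition.
-/

/-! ### Pullbacks and homotopies of cochains -/

namespace BarCochain

section Prism

variable {W W' : Type*} [AddCommGroup W] [AddCommGroup W']

/-- Pullback of cochains along a homomorphism. -/
def comap {R : Type*} (φ : W →+ W') (f : BarCochain R W') : BarCochain R W := fun l => f (l.map φ)

@[simp] theorem comap_apply {R : Type*} (φ : W →+ W') (f : BarCochain R W') (l : List W) :
    comap φ f l = f (l.map φ) := rfl

theorem d_comap (φ : W →+ W') (f : BarCochain (ZMod 2) W') : d (comap φ f) = comap φ (d f) := by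
  ext l
  induction l generalizing f with
  | nil => rfl
  | cons x l ih =>
    cases l with
    | nil => simp
    | cons y l =>
      have h : shift x (comap φ f) = comap φ (shift (φ x) f) := rfl
      rw [d_cons_cons_two, h, ih]
      simp [d_cons_cons_two]

/-- The prism operator between the identity of the bar complex and the endomorphism induced by
`id + κ`. In homogeneous notation it is the sum of the
`f (g₀, …, gᵢ, gᵢ + κ gᵢ, …, gₙ + κ gₙ)` over `i`, where `p = g₀` and the list
consists of the successive differences. -/
def prism (κ : W →+ W) : BarCochain (ZMod 2) W → W → BarCochain (ZMod 2) W
  | f, p, [] => f [κ p]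
  | f, p, g :: l => f (κ p :: (g :: l).map (fun w => w + κ w)) + prism κ (shift g f) (p + g) l

theorem prism_add (κ : W →+ W) (f f' : BarCochain (ZMod 2) W) (p : W) (l : List W) :
    prism κ (f + f') p l = prism κ f p l + prism κ f' p l := by
  induction l generalizing f f' p with
  | nil => simp [prism]
  | cons x l ih => simp only [prism, shift_add, ih, add_apply]; ring

theorem prism_pos (κ : W →+ W) (f : BarCochain (ZMod 2) W) (p : W) (l : List W) :
    prism κ (pos f) p l = prism κ f p l := by
  cases l <;> rfl

theorem prism_smul (κ : W →+ W) (r : ZMod 2) (f : BarCochain (ZMod 2) W) (p : W) (l : List W) :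
    prism κ (r • f) p l = r * prism κ f p l := by
  induction l generalizing f p with
  | nil => rfl
  | cons x l ih =>
    have : shift x (r • f) = r • shift x f := rfl
    simp only [prism, this, ih, smul_apply, mul_add]

/-- The prism operator is a homotopy between the identity and the map induced by `id + κ`. The
first three summands are the coboundary of `prism κ f`, taken in homogeneous notation with base
point `p`. -/
theorem d_prism (κ : W →+ W) (f : BarCochain (ZMod 2) W) (p g : W) (l : List W) :
    prism κ f (p + g) l + d (prism κ f p) (g :: l) + prism κ f p l + prism κ (d f) p (g :: l) =
      f (g :: l) + f ((g :: l).map (fun w => w + κ w)) := by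
  induction l generalizing f p g with
  | nil =>
    simp [prism, d_cons_cons_two]
    rw [show κ p + (g + κ g) = g + (κ p + κ g) by abel]
    grind
  | cons y l ih =>
    have h := ih (shift g f) (p + g) y
    have e0 : shift g (prism κ f p) =
        comap (AddMonoidHom.id W + κ) (shift (g + κ g) (shift (κ p) f))
          + prism κ (shift g f) (p + g) := rfl
    have e1 : prism κ (d f) p (g :: y :: l) = d f (κ p :: (g :: y :: l).map (fun w => w + κ w))
        + prism κ (shift g (d f)) (p + g) (y :: l) := rfl
    have e2 (q : W) : prism κ (trans g f) q (y :: l) =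
        f ((g + κ q) :: (y :: l).map (fun w => w + κ w))
          + prism κ (shift (g + y) f) (q + y) l := rfl
    have e3 (q : W) : prism κ (subst g f) q (y :: l) =
        f (g :: (y :: l).map (fun w => w + κ w)) + prism κ (shift g f) (q + y) l := rfl
    have e4 (f : BarCochain (ZMod 2) W) (q z : W) (l : List W) : prism κ f q (z :: l) =
        f (κ q :: (z :: l).map (fun w => w + κ w)) + prism κ (shift z f) (q + z) l := rfl
    rw [e1, shift_d_two, prism_add, prism_add, prism_add, prism_pos, e2, e3, d_cons_cons_two, e0,
      d_add, add_apply, d_comap, comap_apply]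
    have e5 : d f (κ p :: (g :: y :: l).map (fun w => w + κ w)) =
        f ((g :: y :: l).map (fun w => w + κ w))
        + f ((g + κ (p + g)) :: (y :: l).map (fun w => w + κ w))
        + f (κ p :: (y + g + κ (y + g)) :: l.map (fun w => w + κ w))
        + f (κ p :: (g + κ g) :: l.map (fun w => w + κ w))
        + d (shift (g + κ g) (shift (κ p) f)) ((y :: l).map (fun w => w + κ w)) := by
      simp only [List.map_cons]
      rw [d_cons_cons_two, d_cons_cons_two]
      rw [map_add, map_add, show g + (κ p + κ g) = κ p + (g + κ g) by abel,
        show y + g + (κ y + κ g) = g + κ g + (y + κ y) by abel]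
      simp only [shift_apply]
      grind
    rw [e5]
    have e6 : (y :: l).map ⇑(AddMonoidHom.id W + κ) = (y :: l).map (fun w => w + κ w) := rfl
    rw [e6]
    rw [e4 f p (g + y), e4 f p g]
    rw [add_comm y g]
    rw [← add_assoc p g y]
    simp only [shift_apply, List.map_cons] at h ⊢
    clear ih e0 e1 e2 e3 e4 e5 e6
    grind

theorem IsBounded.prism (κ : W →+ W) {f : BarCochain (ZMod 2) W} (hf : f.IsBounded) (p : W) :
    (prism κ f p).IsBounded := by
  obtain ⟨N, hN⟩ := hf
  refine ⟨N, fun l hl => ?_⟩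
  induction l generalizing f p N with
  | nil => exact hN _ (by simp at hl ⊢; omega)
  | cons g l ih =>
    rw [BarCochain.prism, hN _ (by simp at hl ⊢; omega), zero_add]
    exact ih _ (N - 1) (fun l' hl' => hN (g :: l') (by simp; omega)) (by simp at hl; omega)

/-- The one-cochain of a functional. -/
def ofDual (x : W →+ ZMod 2) : BarCochain (ZMod 2) W
  | [w] => x w
  | _ => 0

theorem shift_ofDual_mul (x : W →+ ZMod 2) (a : BarCochain (ZMod 2) W) (g : W) :
    shift g (ofDual x * a) = x g • a := by
  have h : shift g (ofDual x) = x g • (1 : BarCochain (ZMod 2) W) := by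
    ext l
    cases l <;> simp [ofDual]
  have h0 : ofDual x [] = 0 := rfl
  rw [shift_mul, h, h0, zero_smul, zero_add, smul_mul_assoc, one_mul]

theorem ofDual_mul_nil (x : W →+ ZMod 2) (a : BarCochain (ZMod 2) W) : (ofDual x * a) [] = 0 := by
  simp [ofDual]

@[simp] theorem ofDual_mul_cons (x : W →+ ZMod 2) (a : BarCochain (ZMod 2) W) (g : W)
    (l : List W) : (ofDual x * a) (g :: l) = x g * a l :=
  congrFun (shift_ofDual_mul x a g) l

theorem d_ofDual (x : W →+ ZMod 2) : d (ofDual x) = 0 := by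
  ext l
  match l with
  | [] => rfl
  | [_] => simp
  | [a, b] => simp [d_cons_cons_two, ofDual]; grind
  | a :: b :: c :: l =>
    have h : shift b (shift a (ofDual x)) = 0 := rfl
    rw [d_cons_cons_two]
    have h2 : shift b (d (shift a (ofDual x))) =
      pos (shift a (ofDual x)) + trans b (shift a (ofDual x)) + subst b (shift a (ofDual x)) +
        d (shift b (shift a (ofDual x))) := shift_d_two _ _
    have h3 := congrFun h2 (c :: l)
    rw [shift] at h3
    rw [h3, h, d_zero]
    simp [ofDual]

theorem isBounded_ofDual (x : W →+ ZMod 2) : (ofDual x).IsBounded :=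
  ⟨2, fun l hl => by
    match l with
    | [] => simp at hl
    | [_] => simp at hl
    | _ :: _ :: _ => rfl⟩

/-- A pair `(a, b)` with `d a = 0` and `d b = x ∪ a` is a cocycle of the
cone of `x ∪ ·`, which computes the cohomology of `ker x`. If `b` vanishes on the image of the
projection `w ↦ w + x(w) e` onto `ker x`, the pair is a coboundary. -/
theorem exists_primitive_of_cone {x : W →+ ZMod 2} {κ : W →+ W} {e : W}
    (hκ : ∀ w, κ w = if x w = 0 then 0 else e) (he : x e = 1)
    {a b : BarCochain (ZMod 2) W} (ha : a.IsBounded) (hb : b.IsBounded) (hda : d a = 0)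
    (hdb : d b = ofDual x * a) (h0 : ∀ l : List W, b (l.map (fun w => w + κ w)) = 0) :
    ∃ a' b' : BarCochain (ZMod 2) W, a'.IsBounded ∧ b'.IsBounded ∧ d a' = a ∧
      b = d b' + ofDual x * a' := by
  -- Since `κ` factors through `x`, so does the dependence of `prism κ` on the base point.
  have hpr (f : BarCochain (ZMod 2) W) (p q : W) (l : List W) (hpq : x p = x q) :
      prism κ f p l = prism κ f q l := by
    induction l generalizing f p q with
    | nil => simp [prism, hκ, hpq]
    | cons y l ih =>
      rw [prism, prism, ih _ (p + y) (q + y) (by simp [hpq]), hκ p, hκ q, hpq]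
  have hκ0 : κ 0 = 0 := map_zero κ
  have hκe : κ e = e := by rw [hκ, he]; simp
  have hx (p g : W) (l : List W) : prism κ (d b) p (g :: l) =
      x (κ p) * a ((g :: l).map (fun w => w + κ w)) + x g * prism κ a (p + g) l := by
    rw [hdb, prism, shift_ofDual_mul, prism_smul, ofDual_mul_cons]
  have hz (g : W) : x g = 0 ∨ x g = 1 := by
    generalize x g = t
    revert t; decide
  have h1 (g : W) (l : List W) : b (g :: l) =
      d (prism κ b 0) (g :: l) + x g * (prism κ (a + b) e l + prism κ b 0 l) := by
    have h := d_prism κ b 0 g l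
    rw [h0, hx, hκ0, map_zero, zero_add, add_zero] at h
    rw [← h, prism_add]
    rcases hz g with hg | hg
    · rw [hg, hpr b g 0 l (by simp [hg])]
      grind
    · rw [hg, hpr b g e l (by simp [hg, he]), hpr a g e l (by simp [hg, he])]
      grind
  have ha0 : a [] = 0 := by
    have h := congrFun hdb [e]
    rw [d_singleton, ofDual_mul_cons, he, one_mul] at h
    exact h.symm
  have h2 (g : W) (l : List W) : a (g :: l) =
      d (prism κ (a + b) e) (g :: l) + d (prism κ b 0) (g :: l) := by
    have h := d_prism κ (a + b) e g l
    have h' := h1 g l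
    rw [d_add, hda, zero_add, hx, hκe, he, one_mul, add_apply, add_apply, h0, add_zero] at h
    rw [prism_add] at h' h
    rw [prism_add] at h
    rcases hz g with hg | hg
    · rw [hg, hpr b (e + g) e l (by simp [hg]), hpr a (e + g) e l (by simp [hg])] at h
      rw [hg] at h'
      grind
    · have h11 : (1 : ZMod 2) + 1 = 0 := rfl
      rw [hg, hpr b (e + g) 0 l (by simp [hg, he, h11]),
        hpr a (e + g) 0 l (by simp [hg, he, h11])] at h
      rw [hg] at h'
      grind
  -- The homotopy formula for `b` at base point `0` (`h1`) and for `a + b` at base point `e` (`h2`)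
  -- exhibits the primitive.
  refine ⟨prism κ (a + b) e + prism κ b 0, prism κ b 0, ((ha.add hb).prism κ e).add (hb.prism κ 0),
    hb.prism κ 0, ?_, ?_⟩
  · ext l
    cases l with
    | nil => rw [ha0]; rfl
    | cons g l => rw [d_add, add_apply, h2]
  · ext l
    cases l with
    | nil =>
      rw [add_apply, ofDual_mul_nil]
      exact h0 []
    | cons g l => rw [add_apply, ofDual_mul_cons, add_apply, h1]

end Prism

end BarCochain

/-! ### The cohomology algebra of an elementary abelian 2-group -/

namespace BarCochain

section Components

variable {W W' : Type*} [AddCommGroup W] [AddCommGroup W']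

/-- The component of a cochain in degree `m`. -/
def comp (m : ℕ) (f : BarCochain (ZMod 2) W) : BarCochain (ZMod 2) W :=
  fun l => if l.length = m then f l else 0

theorem comp_apply (m : ℕ) (f : BarCochain (ZMod 2) W) (l : List W) :
    comp m f l = if l.length = m then f l else 0 := rfl

theorem comp_add (m : ℕ) (f g : BarCochain (ZMod 2) W) : comp m (f + g) = comp m f + comp m g := by
  ext l
  simp only [comp_apply, add_apply]
  split <;> simp

theorem isBounded_comp (m : ℕ) (f : BarCochain (ZMod 2) W) : (comp m f).IsBounded :=
  ⟨m + 1, fun l hl => if_neg (by omega)⟩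

theorem comp_zero_d (f : BarCochain (ZMod 2) W) : comp 0 (d f) = 0 := by
  ext l
  cases l <;> simp [comp_apply]

theorem shift_comp_succ (x : W) (m : ℕ) (f : BarCochain (ZMod 2) W) :
    shift x (comp (m + 1) f) = comp m (shift x f) := by
  ext l
  simp [comp_apply]

theorem d_comp (m : ℕ) (f : BarCochain (ZMod 2) W) : d (comp m f) = comp (m + 1) (d f) := by
  ext l
  induction l generalizing f m with
  | nil => simp [comp_apply]
  | cons x l ih =>
    cases l with
    | nil => simp [comp_apply]
    | cons y l =>
      rw [d_cons_cons_two]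
      cases m with
      | zero =>
        have h : shift x (comp 0 f) = 0 := by
          ext l
          simp [comp_apply]
        simp [h, d_zero, comp_apply]
      | succ m =>
        rw [shift_comp_succ, ih]
        simp only [comp_apply, d_cons_cons_two, List.length_cons, Nat.add_right_cancel_iff]
        split <;> simp

theorem comp_zero_ofDual_mul (x : W →+ ZMod 2) (a : BarCochain (ZMod 2) W) :
    comp 0 (ofDual x * a) = 0 := by
  ext l
  cases l with
  | nil => rw [comp_apply, ofDual_mul_nil]; simp
  | cons g l => simp [comp_apply]

theorem comp_succ_ofDual_mul (x : W →+ ZMod 2) (m : ℕ) (a : BarCochain (ZMod 2) W) :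
    comp (m + 1) (ofDual x * a) = ofDual x * comp m a := by
  ext l
  cases l with
  | nil => rw [ofDual_mul_nil]; simp [comp_apply]
  | cons g l =>
    simp only [comp_apply, ofDual_mul_cons, List.length_cons, Nat.add_right_cancel_iff]
    split <;> simp

theorem comap_mul (φ : W →+ W') (f g : BarCochain (ZMod 2) W') :
    comap φ (f * g) = comap φ f * comap φ g := by
  ext l
  simp [mul_apply, List.map_take, List.map_drop]

theorem comap_one (φ : W →+ W') : comap φ (1 : BarCochain (ZMod 2) W') = 1 := by
  ext l
  cases l <;> rfl

theorem IsBounded.comap (φ : W →+ W') {f : BarCochain (ZMod 2) W'} (hf : f.IsBounded) :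
    (comap φ f).IsBounded := by
  obtain ⟨N, hN⟩ := hf
  exact ⟨N, fun l hl => hN _ (by simpa using hl)⟩

theorem comap_ofDual (φ : W →+ W') (x : W' →+ ZMod 2) :
    comap φ (ofDual x) = ofDual (x.comp φ) := by
  ext l
  match l with
  | [] => rfl
  | [_] => rfl
  | _ :: _ :: _ => rfl

theorem ofDual_zero : ofDual (0 : W →+ ZMod 2) = 0 := by
  ext l
  match l with
  | [] => rfl
  | [_] => rfl
  | _ :: _ :: _ => rfl

/-- Pullback of cocycles along a homomorphism. -/
def cocycleComap (φ : W →+ W') : cocycleAlgebra W' →ₐ[ZMod 2] cocycleAlgebra W where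
  toFun z := ⟨comap φ z, z.2.1.comap φ, by rw [d_comap, z.2.2]; rfl⟩
  map_one' := Subtype.ext (comap_one φ)
  map_mul' z z' := Subtype.ext (comap_mul φ z z')
  map_zero' := rfl
  map_add' _ _ := rfl
  commutes' r := Subtype.ext (by
    change comap φ (algebraMap (ZMod 2) (BarCochain (ZMod 2) W') r)
      = algebraMap (ZMod 2) (BarCochain (ZMod 2) W) r
    rw [Algebra.algebraMap_eq_smul_one, Algebra.algebraMap_eq_smul_one, ← comap_one φ]
    rfl)

end Components

end BarCochain

namespace ModTwoCohomology

open BarCochain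

variable {W W' : Type*} [AddCommGroup W] [AddCommGroup W']

/-- `mk` as an algebra homomorphism. -/
def mkHom (W : Type*) [AddCommGroup W] : cocycleAlgebra W →ₐ[ZMod 2] ModTwoCohomology W :=
  Ideal.Quotient.mkₐ (ZMod 2) (coboundaryIdeal W)

theorem mkHom_surjective : Function.Surjective (mkHom W) :=
  Ideal.Quotient.mkₐ_surjective (ZMod 2) (coboundaryIdeal W)

theorem mkHom_eq_zero {z : cocycleAlgebra W} :
    mkHom W z = 0 ↔ ∃ u : BarCochain (ZMod 2) W, u.IsBounded ∧ d u = z :=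
  Ideal.Quotient.eq_zero_iff_mem

/-- Functoriality of the cohomology algebra. -/
def pullback (φ : W →+ W') : ModTwoCohomology W' →ₐ[ZMod 2] ModTwoCohomology W :=
  Ideal.Quotient.liftₐ (coboundaryIdeal W') ((mkHom W).comp (cocycleComap φ)) (by
    rintro z ⟨u, hu, hz⟩
    exact mkHom_eq_zero.2 ⟨comap φ u, hu.comap φ, by rw [d_comap, hz]; rfl⟩)

theorem pullback_mkHom (φ : W →+ W') (z : cocycleAlgebra W') :
    pullback φ (mkHom W' z) = mkHom W (cocycleComap φ z) := rfl

/-- The degree one class of a functional. -/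
def dualClass (x : W →+ ZMod 2) : ModTwoCohomology W :=
  mkHom W ⟨ofDual x, isBounded_ofDual x, d_ofDual x⟩

theorem pullback_dualClass (φ : W →+ W') (x : W' →+ ZMod 2) :
    pullback φ (dualClass x) = dualClass (x.comp φ) := by
  rw [dualClass, pullback_mkHom]
  exact congrArg (mkHom W) (Subtype.ext (comap_ofDual φ x))

theorem pullback_pullback {W'' : Type*} [AddCommGroup W''] (φ : W →+ W') (ψ : W' →+ W'')
    (y : ModTwoCohomology W'') : pullback φ (pullback ψ y) = pullback (ψ.comp φ) y := by
  obtain ⟨z, rfl⟩ := mkHom_surjective y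
  rw [pullback_mkHom, pullback_mkHom, pullback_mkHom]
  refine congrArg (mkHom W) (Subtype.ext (BarCochain.ext fun l => ?_))
  change (z : BarCochain (ZMod 2) W'') ((l.map φ).map ψ) = (z : BarCochain (ZMod 2) W'') _
  rw [List.map_map]
  rfl

theorem pullback_id (y : ModTwoCohomology W) : pullback (AddMonoidHom.id W) y = y := by
  obtain ⟨z, rfl⟩ := mkHom_surjective y
  rw [pullback_mkHom]
  refine congrArg (mkHom W) (Subtype.ext (BarCochain.ext fun l => ?_))
  change (z : BarCochain (ZMod 2) W) (l.map id) = _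
  rw [List.map_id]

theorem dualClass_zero : dualClass (0 : W →+ ZMod 2) = 0 :=
  mkHom_eq_zero.2 ⟨0, isBounded_zero, by rw [d_zero]; exact ofDual_zero.symm⟩

/-- The class `y` is homogeneous of degree `m`. -/
def IsHomogeneous (m : ℕ) (y : ModTwoCohomology W) : Prop :=
  ∃ z : cocycleAlgebra W, comp m (z : BarCochain (ZMod 2) W) = z ∧ mkHom W z = y

theorem IsHomogeneous.pullback {m : ℕ} {y : ModTwoCohomology W'} (hy : IsHomogeneous m y)
    (φ : W →+ W') : IsHomogeneous m (pullback φ y) := by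
  obtain ⟨z, hz, rfl⟩ := hy
  refine ⟨cocycleComap φ z, ?_, rfl⟩
  ext l
  have h := congrFun hz (l.map φ)
  rw [comp_apply, List.length_map] at h
  exact h

/-- Every class is a sum of homogeneous classes. -/
theorem induction_homogeneous {P : ModTwoCohomology W → Prop} (h0 : P 0)
    (hadd : ∀ y z, P y → P z → P (y + z)) (hP : ∀ m y, IsHomogeneous m y → P y)
    (y : ModTwoCohomology W) : P y := by
  obtain ⟨⟨f, ⟨N, hN⟩, hd⟩, rfl⟩ := mkHom_surjective y
  induction N generalizing f with
  | zero =>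
    obtain rfl : f = 0 := BarCochain.ext fun l => hN l (Nat.zero_le _)
    exact (map_zero (mkHom W)).symm ▸ h0
  | succ N ih =>
    have hdc : d (comp N f) = 0 := by
      rw [d_comp, hd]
      ext l
      simp [comp_apply]
    let z : cocycleAlgebra W := ⟨comp N f, isBounded_comp N f, hdc⟩
    have h1 : (⟨f, ⟨N + 1, hN⟩, hd⟩ : cocycleAlgebra W) =
        (⟨f + comp N f, IsBounded.add ⟨N + 1, hN⟩ (isBounded_comp N f),
          by rw [d_add, hd, hdc, add_zero]⟩ : cocycleAlgebra W) + z := by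
      refine Subtype.ext ?_
      change f = f + comp N f + comp N f
      ext l
      rw [BarCochain.add_apply, BarCochain.add_apply]
      grind
    rw [h1, map_add]
    refine hadd _ _ (ih _ (by rw [d_add, hd, hdc, add_zero]) fun l hl => ?_) (hP N _ ⟨z, ?_, rfl⟩)
    · rw [BarCochain.add_apply, comp_apply]
      split
      · exact CharTwo.add_self_eq_zero _
      · rw [hN l (by omega), add_zero]
    · ext l
      change comp N (comp N f) l = comp N f l
      simp only [comp_apply]
      split <;> rfl

/-- A splitting `W ≅ W' ⊕ ⟨e⟩` where `W'` is identified with the kernel of `x : W → 𝔽₂`. The map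
`κ` is `w ↦ x(w) e`, so that `w ↦ w + κ(w)` is the projection of `W` onto the kernel of `x`. -/
structure Splitting (W W' : Type*) [AddCommGroup W] [AddCommGroup W'] where
  /-- The functional with kernel `W'`. -/
  x : W →+ ZMod 2
  /-- The vector spanning the complement. -/
  e : W
  /-- The inclusion. -/
  i : W' →+ W
  /-- The projection. -/
  p : W →+ W'
  /-- The difference `w ↦ x(w) e` between the projection and the identity. -/
  κ : W →+ W
  x_e : x e = 1
  κ_apply : ∀ w, κ w = if x w = 0 then 0 else e
  p_i : p.comp i = AddMonoidHom.id W'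
  i_p : ∀ w, i (p w) = w + κ w
  x_i : x.comp i = 0

namespace Splitting

variable (S : Splitting W W')

theorem pullback_i_pullback_p (y : ModTwoCohomology W') :
    pullback S.i (pullback S.p y) = y := by
  rw [pullback_pullback, S.p_i, pullback_id]

theorem pullback_i_dualClass : pullback S.i (dualClass S.x) = 0 := by
  rw [pullback_dualClass, S.x_i, dualClass_zero]

theorem apply_map_eq_zero {b : BarCochain (ZMod 2) W} (h : comap S.i b = 0) (l : List W) :
    b (l.map (fun w => w + S.κ w)) = 0 := by
  have h1 := congrFun h (l.map S.p)
  rw [comap_apply, List.map_map] at h1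
  rw [show (fun w => w + S.κ w) = S.i ∘ S.p from funext fun w => (S.i_p w).symm]
  exact h1

theorem comap_i_comap_p (c : BarCochain (ZMod 2) W') : comap S.i (comap S.p c) = c := by
  ext l
  rw [comap_apply, comap_apply, List.map_map]
  have h : (S.p ∘ S.i : W' → W') = id := funext fun w => DFunLike.congr_fun S.p_i w
  rw [h, List.map_id]

/-- The kernel of the restriction to `ker x` is generated by the class of `x`, degree by degree. -/
theorem exists_eq_dualClass_mul {f : BarCochain (ZMod 2) W} (hf : f ∈ cocycleAlgebra W)
    (h : pullback S.i (mkHom W ⟨f, hf⟩) = 0) :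
    ∃ a ∈ cocycleAlgebra W, ∃ u : BarCochain (ZMod 2) W, f = d u + ofDual S.x * a := by
  obtain ⟨c, hc, hcf⟩ := mkHom_eq_zero.1 h
  have hcf' : d c = comap S.i f := hcf
  have hb : (f + d (comap S.p c)).IsBounded := hf.1.add (hc.comap _).d
  have hdb : d (f + d (comap S.p c)) = ofDual S.x * 0 := by
    rw [d_add, hf.2, mul_zero, zero_add]
    exact BarCochain.ext fun l => d_d _ _
  obtain ⟨a', b', ha', hb', hda, hbeq⟩ := exists_primitive_of_cone S.κ_apply S.x_e
    isBounded_zero hb d_zero hdb (S.apply_map_eq_zero (by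
      change comap S.i f + comap S.i (d (comap S.p c)) = 0
      rw [← d_comap, comap_i_comap_p, hcf']
      ext l
      exact CharTwo.add_self_eq_zero _))
  refine ⟨a', ⟨ha', hda⟩, b' + comap S.p c, ?_⟩
  ext l
  have hl := congrFun hbeq l
  rw [d_add, BarCochain.add_apply, BarCochain.add_apply]
  rw [show (f + d (comap S.p c)) l = f l + d (comap S.p c) l from rfl,
    show (d b' + ofDual S.x * a') l = d b' l + (ofDual S.x * a') l from rfl] at hl
  grind

/-- The class of `x` is not a zero divisor. -/
theorem eq_zero_of_dualClass_mul {y : ModTwoCohomology W} (h : dualClass S.x * y = 0) :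
    y = 0 := by
  obtain ⟨⟨a, ha⟩, rfl⟩ := mkHom_surjective y
  rw [dualClass, ← map_mul] at h
  obtain ⟨u, hu, hua⟩ := mkHom_eq_zero.1 h
  have hua' : d u = ofDual S.x * a := hua
  have hdb : d (u + comap S.p (comap S.i u)) = ofDual S.x * a := by
    rw [d_add, d_comap, d_comap, hua', comap_mul, comap_ofDual, S.x_i, BarCochain.ofDual_zero,
      zero_mul]
    exact add_zero _
  obtain ⟨a', -, ha', -, hda, -⟩ := exists_primitive_of_cone S.κ_apply S.x_e
    ha.1 (hu.add ((hu.comap _).comap _)) ha.2 hdb (S.apply_map_eq_zero (by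
      change comap S.i u + comap S.i (comap S.p (comap S.i u)) = 0
      rw [comap_i_comap_p]
      ext l
      exact CharTwo.add_self_eq_zero _))
  exact mkHom_eq_zero.2 ⟨a', ha', hda⟩

end Splitting

/-- The algebra homomorphism from a polynomial ring that sends the variables to the degree one
classes of given functionals. -/
noncomputable def polyHom {n : ℕ} (x : Fin n → W →+ ZMod 2) :
    MvPolynomial (Fin n) (ZMod 2) →ₐ[ZMod 2] ModTwoCohomology W :=
  MvPolynomial.aeval fun j => dualClass (x j)

theorem polyHom_X {n : ℕ} (x : Fin n → W →+ ZMod 2) (j : Fin n) :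
    polyHom x (MvPolynomial.X j) = dualClass (x j) :=
  MvPolynomial.aeval_X _ _

theorem pullback_polyHom {n : ℕ} (φ : W →+ W') (x : Fin n → W' →+ ZMod 2)
    (p : MvPolynomial (Fin n) (ZMod 2)) :
    pullback φ (polyHom x p) = polyHom (fun j => (x j).comp φ) p := by
  have h : (pullback φ).comp (polyHom x) = polyHom (fun j => (x j).comp φ) := by
    refine MvPolynomial.algHom_ext fun j => ?_
    rw [AlgHom.comp_apply, polyHom_X, polyHom_X, pullback_dualClass]
  rw [← h, AlgHom.comp_apply]

/-- `polyHom x` is injective, and surjective in each degree. -/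
def IsPolynomialOn {n : ℕ} (x : Fin n → W →+ ZMod 2) : Prop :=
  Function.Injective (polyHom x) ∧ ∀ m y, IsHomogeneous m y →
    ∃ p : MvPolynomial (Fin n) (ZMod 2), p.IsHomogeneous m ∧ polyHom x p = y

theorem IsPolynomialOn.bijective {n : ℕ} {x : Fin n → W →+ ZMod 2} (h : IsPolynomialOn x) :
    Function.Bijective (polyHom x) := by
  refine ⟨h.1, fun y => ?_⟩
  induction y using induction_homogeneous with
  | h0 => exact ⟨0, map_zero _⟩
  | hadd y z hy hz =>
    obtain ⟨p, rfl⟩ := hy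
    obtain ⟨q, rfl⟩ := hz
    exact ⟨p + q, map_add _ _ _⟩
  | hP m y hy =>
    obtain ⟨p, -, hp⟩ := h.2 m y hy
    exact ⟨p, hp⟩

/-- Induction step: the restriction to `W'` is split surjective, and its kernel is generated by the
nonzerodivisor `dualClass S.x`. Surjectivity is proved degree by degree because dividing a class of
the kernel by `dualClass S.x` lowers the degree. -/
theorem Splitting.isPolynomialOn (S : Splitting W W') {n : ℕ} {x' : Fin n → W' →+ ZMod 2}
    (h : IsPolynomialOn x') :
    IsPolynomialOn (Fin.cons S.x fun j => (x' j).comp S.p : Fin (n + 1) → W →+ ZMod 2) := by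
  set x : Fin (n + 1) → W →+ ZMod 2 := Fin.cons S.x fun j => (x' j).comp S.p with hx
  have hren (q : MvPolynomial (Fin n) (ZMod 2)) :
      polyHom x (MvPolynomial.rename Fin.succ q) = pullback S.p (polyHom x' q) := by
    rw [pullback_polyHom, polyHom, MvPolynomial.aeval_rename]
    rfl
  have hX : polyHom x (MvPolynomial.X 0) = dualClass S.x := polyHom_X _ _
  constructor
  -- Injectivity: restriction to `W'` kills the constant coefficient of a relation in `X₀`, and the
  -- remaining factor `X₀` can be cancelled.
  · let θ : Polynomial (MvPolynomial (Fin n) (ZMod 2)) →+* ModTwoCohomology W :=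
      (polyHom x : MvPolynomial (Fin (n + 1)) (ZMod 2) →+* ModTwoCohomology W).comp
        ((MvPolynomial.finSuccEquiv (ZMod 2) n).symm :
          Polynomial (MvPolynomial (Fin n) (ZMod 2)) →+* _)
    have hθX : θ Polynomial.X = dualClass S.x := by
      change polyHom x ((MvPolynomial.finSuccEquiv (ZMod 2) n).symm Polynomial.X) = _
      rw [← MvPolynomial.finSuccEquiv_X_zero, AlgEquiv.symm_apply_apply, hX]
    have hθC (q) : θ (Polynomial.C q) = pullback S.p (polyHom x' q) := by
      change polyHom x ((MvPolynomial.finSuccEquiv (ZMod 2) n).symm (Polynomial.C q)) = _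
      rw [← hren]
      congr 1
      rw [AlgEquiv.symm_apply_eq]
      induction q using MvPolynomial.induction_on with
      | C r => simp [MvPolynomial.finSuccEquiv_apply]
      | add p q hp hq => rw [map_add, map_add, map_add, hp, hq]
      | mul_X p j hp => rw [map_mul, map_mul, map_mul, hp, MvPolynomial.rename_X,
          MvPolynomial.finSuccEquiv_X_succ]
    have hθ (N : ℕ) (P : Polynomial (MvPolynomial (Fin n) (ZMod 2))) (hN : P.natDegree < N)
        (hP : θ P = 0) : P = 0 := by
      induction N generalizing P with
      | zero => omega
      | succ N ih =>
        rw [← Polynomial.divX_mul_X_add P, map_add, map_mul, hθX, hθC] at hP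
        have h1 := congrArg (pullback S.i) hP
        rw [map_add, map_mul, S.pullback_i_dualClass, mul_zero, zero_add,
          S.pullback_i_pullback_p, map_zero] at h1
        have h2 : P.coeff 0 = 0 := h.1 (h1.trans (map_zero _).symm)
        rw [h2, map_zero, map_zero, add_zero, mul_comm] at hP
        have h3 := S.eq_zero_of_dualClass_mul hP
        have h4 : P.divX = 0 := by
          by_cases hd : P.natDegree = 0
          · exact Polynomial.divX_eq_zero_iff.2 (Polynomial.eq_C_of_natDegree_eq_zero hd)
          · exact ih _ (by rw [Polynomial.natDegree_divX_eq_natDegree_tsub_one]; omega) h3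
        rw [← Polynomial.divX_mul_X_add P, h2, h4]
        simp
    rw [injective_iff_map_eq_zero]
    intro q hq
    have := hθ _ (MvPolynomial.finSuccEquiv (ZMod 2) n q) (Nat.lt_succ_self _) (by
      change polyHom x ((MvPolynomial.finSuccEquiv (ZMod 2) n).symm _) = 0
      rw [AlgEquiv.symm_apply_apply, hq])
    simpa using this
  -- Surjectivity: subtract the class pulled back from `W'`, and divide the rest by the class of `x`.
  · have hred (m : ℕ) (y : ModTwoCohomology W) (hy : IsHomogeneous m y) :
        ∃ g ∈ cocycleAlgebra W, ∃ hg, comp m g = g ∧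
          y = pullback S.p (pullback S.i y) + mkHom W ⟨g, hg⟩ ∧
          ∃ a ∈ cocycleAlgebra W, ∃ u : BarCochain (ZMod 2) W, g = d u + ofDual S.x * a := by
      obtain ⟨z, hz, hzy⟩ := hy.pullback S.i |>.pullback S.p
      obtain ⟨f, hf, rfl⟩ := hy
      have h1 : mkHom W f = mkHom W z + mkHom W (f - z) := by
        rw [map_sub]
        abel
      have h2 : pullback S.i (mkHom W (f - z)) = 0 := by
        rw [map_sub, map_sub, hzy, S.pullback_i_pullback_p, sub_self]
      refine ⟨_, (f - z).2, (f - z).2, ?_, ?_, S.exists_eq_dualClass_mul (f - z).2 h2⟩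
      · change comp m ((f : BarCochain (ZMod 2) W) - (z : BarCochain (ZMod 2) W)) =
          (f : BarCochain (ZMod 2) W) - (z : BarCochain (ZMod 2) W)
        rw [sub_eq_add_neg, ← neg_one_smul (ZMod 2), show (-1 : ZMod 2) = 1 from rfl, one_smul,
          comp_add, hf, hz]
      · rw [← hzy]
        exact h1
    intro m
    induction m with
    | zero =>
      intro y hy
      obtain ⟨p, hp, hpy⟩ := h.2 0 _ (hy.pullback S.i)
      obtain ⟨g, -, hg, hgc, hyg, a, -, u, hu⟩ := hred 0 y hy
      have h0 : g = 0 := by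
        rw [← hgc, hu, comp_add, comp_zero_d, comp_zero_ofDual_mul, add_zero]
      refine ⟨MvPolynomial.rename Fin.succ p, hp.rename_isHomogeneous, ?_⟩
      subst h0
      rw [hren, hpy]
      conv_rhs => rw [hyg]
      exact (add_zero _).symm.trans (congrArg (_ + ·) (map_zero (mkHom W)).symm)
    | succ m ih =>
      intro y hy
      obtain ⟨p, hp, hpy⟩ := h.2 (m + 1) _ (hy.pullback S.i)
      obtain ⟨g, -, hg, hgc, hyg, a, ha, u, hu⟩ := hred (m + 1) y hy
      have h0 : g = d (comp m u) + ofDual S.x * comp m a := by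
        rw [← hgc, hu, comp_add, d_comp, comp_succ_ofDual_mul]
      have hca : comp m a ∈ cocycleAlgebra W := by
        refine ⟨isBounded_comp m a, ?_⟩
        rw [d_comp, ha.2]
        ext l
        simp [comp_apply]
      obtain ⟨q, hq, hqy⟩ := ih (mkHom W ⟨comp m a, hca⟩) ⟨⟨comp m a, hca⟩, by
        ext l
        change comp m (comp m a) l = comp m a l
        simp only [comp_apply]
        split <;> rfl, rfl⟩
      refine ⟨MvPolynomial.rename Fin.succ p + MvPolynomial.X 0 * q,
        hp.rename_isHomogeneous.add ?_, ?_⟩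
      · rw [add_comm m 1]
        exact (MvPolynomial.isHomogeneous_X _ _).mul hq
      · rw [map_add, map_mul, hren, hpy, hX, hqy]
        conv_rhs => rw [hyg]
        refine congrArg (pullback S.p (pullback S.i y) + ·) ?_
        rw [dualClass, ← map_mul, ← sub_eq_zero, ← map_sub]
        refine mkHom_eq_zero.2 ⟨- comp m u, ?_, ?_⟩
        · rw [← neg_one_smul (ZMod 2)]
          exact (isBounded_comp m u).smul _
        · change d (- comp m u) = ofDual S.x * comp m a - g
          rw [h0, ← neg_one_smul (ZMod 2), d_smul, neg_one_smul]
          abel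

/-- Over the trivial group, prepending `0` to the arguments is a contraction of the bar complex in
positive degrees. -/
theorem isPolynomialOn_of_subsingleton [Subsingleton W] (x : Fin 0 → W →+ ZMod 2) :
    IsPolynomialOn x := by
  have hmk (r : ZMod 2) : polyHom x (MvPolynomial.C r) = mkHom W (algebraMap _ _ r) := by
    rw [polyHom, MvPolynomial.aeval_C, AlgHom.commutes]
  constructor
  · rw [injective_iff_map_eq_zero]
    intro p hp
    obtain ⟨r, rfl⟩ := MvPolynomial.C_surjective (Fin 0) p
    rw [hmk] at hp
    obtain ⟨u, hu, hur⟩ := mkHom_eq_zero.1 hp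
    have h1 := congrFun hur []
    have h2 : (algebraMap (ZMod 2) (BarCochain (ZMod 2) W) r) [] = r := by
      rw [Algebra.algebraMap_eq_smul_one, BarCochain.smul_apply, one_nil, mul_one]
    have h3 : r = 0 := h2.symm.trans h1.symm
    rw [h3, map_zero]
  · rintro m _ ⟨f, hf, rfl⟩
    cases m with
    | zero =>
      refine ⟨MvPolynomial.C ((f : BarCochain (ZMod 2) W) []), MvPolynomial.isHomogeneous_C _ _, ?_⟩
      rw [hmk]
      refine congrArg (mkHom W) (Subtype.ext ?_)
      ext l
      change (algebraMap (ZMod 2) (BarCochain (ZMod 2) W) _) l = _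
      rw [Algebra.algebraMap_eq_smul_one, BarCochain.smul_apply, ← hf]
      cases l with
      | nil => simp
      | cons y l => simp [comp_apply]
    | succ m =>
      refine ⟨0, MvPolynomial.isHomogeneous_zero _ _ _, ?_⟩
      rw [map_zero, eq_comm, mkHom_eq_zero]
      refine ⟨shift 0 (f : BarCochain (ZMod 2) W), ?_, ?_⟩
      · obtain ⟨N, hN⟩ := f.2.1
        exact ⟨N, fun l hl => hN _ (by simp; omega)⟩
      · ext l
        cases l with
        | nil =>
          rw [← hf, comp_apply]
          simp
        | cons y l =>
          have h := congrFun (shift_d_two 0 (f : BarCochain (ZMod 2) W)) (y :: l)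
          obtain rfl : y = 0 := Subsingleton.elim _ _
          rw [f.2.2] at h
          simp only [shift_apply, BarCochain.zero_apply, BarCochain.add_apply, pos_cons,
            trans_cons, subst_cons, add_zero] at h
          grind

section Basis

variable [Module (ZMod 2) W]

/-- A basis vector splits off. -/
noncomputable def splittingOfBasis {n : ℕ} (c : Module.Basis (Fin (n + 1)) (ZMod 2) W) :
    Splitting W (Fin n → ZMod 2) where
  x := (c.coord 0).toAddMonoidHom
  e := c 0
  i := (∑ j : Fin n, (LinearMap.proj j : (Fin n → ZMod 2) →ₗ[ZMod 2] ZMod 2).smulRight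
    (c j.succ)).toAddMonoidHom
  p := (LinearMap.pi fun j : Fin n => c.coord j.succ).toAddMonoidHom
  κ := ((c.coord 0).smulRight (c 0)).toAddMonoidHom
  x_e := by simp
  κ_apply w := by
    have hz (t : ZMod 2) : t = 0 ∨ t = 1 := by revert t; decide
    rcases hz (c.repr w 0) with h | h <;> simp [h]
  p_i := by
    ext v j
    simp [Finsupp.single_apply, Pi.single_apply, eq_comm]
  i_p w := by
    have h : c.repr w 0 • c 0 + c.repr w 0 • c 0 = 0 := ZModModule.add_self _
    conv_rhs => rw [← c.sum_repr w, Fin.sum_univ_succ]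
    simp
    rw [add_right_comm, h, zero_add]
  x_i := by
    ext v
    simp

theorem isPolynomialOn_coord_succ {n : ℕ} (c : Module.Basis (Fin (n + 1)) (ZMod 2) W)
    (h : IsPolynomialOn fun j => ((Pi.basisFun (ZMod 2) (Fin n)).coord j).toAddMonoidHom) :
    IsPolynomialOn fun j => (c.coord j).toAddMonoidHom := by
  have h1 := (splittingOfBasis c).isPolynomialOn h
  convert h1 using 1
  ext j w
  refine Fin.cases ?_ (fun j => ?_) j
  · rfl
  · simp [splittingOfBasis]

/-- The cohomology algebra of an elementary abelian `2`-group is polynomial on the dual basis. -/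
theorem isPolynomialOn_coord {n : ℕ} (c : Module.Basis (Fin n) (ZMod 2) W) :
    IsPolynomialOn fun j => (c.coord j).toAddMonoidHom := by
  have base (n : ℕ) :
      IsPolynomialOn fun j => ((Pi.basisFun (ZMod 2) (Fin n)).coord j).toAddMonoidHom := by
    induction n with
    | zero => exact isPolynomialOn_of_subsingleton _
    | succ n ih => exact isPolynomialOn_coord_succ _ ih
  cases n with
  | zero =>
    have : Subsingleton W := c.repr.toEquiv.subsingleton
    exact isPolynomialOn_of_subsingleton _
  | succ n => exact isPolynomialOn_coord_succ c (base n)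

end Basis

end ModTwoCohomology

/-! ### Quadratic polynomials, the Bockstein operator and the `k`-invariants -/

/-- The quadratic form `∑ aⱼₖ XⱼXₖ`. -/
noncomputable def quadPoly {n : ℕ} (a : Fin n → Fin n → ZMod 2) :
    MvPolynomial (Fin n) (ZMod 2) :=
  ∑ j, ∑ k, a j k • (MvPolynomial.X j * MvPolynomial.X k)

/-- The value `∑ aⱼₖ (Xⱼ²Xₖ + XⱼXₖ²)` on `quadPoly a` of the derivation with `Xⱼ ↦ Xⱼ²`. -/
noncomputable def quadDer {n : ℕ} (a : Fin n → Fin n → ZMod 2) :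
    MvPolynomial (Fin n) (ZMod 2) :=
  ∑ j, ∑ k, a j k • (MvPolynomial.X j ^ 2 * MvPolynomial.X k +
    MvPolynomial.X j * MvPolynomial.X k ^ 2)

theorem isHomogeneous_quadPoly {n : ℕ} (a : Fin n → Fin n → ZMod 2) :
    (quadPoly a).IsHomogeneous 2 := by
  refine MvPolynomial.IsHomogeneous.sum _ _ _ fun j _ => MvPolynomial.IsHomogeneous.sum _ _ _
    fun k _ => ?_
  exact (MvPolynomial.homogeneousSubmodule (Fin n) (ZMod 2) 2).smul_mem _
    ((MvPolynomial.isHomogeneous_X _ _).mul (MvPolynomial.isHomogeneous_X _ _))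

theorem exists_eq_quadPoly {n : ℕ} {p : MvPolynomial (Fin n) (ZMod 2)} (hp : p.IsHomogeneous 2) :
    ∃ a, p = quadPoly a := by
  rw [p.as_sum]
  refine Finset.sum_induction _ (fun p => ∃ a, p = quadPoly a) ?_ ⟨0, by simp [quadPoly]⟩ ?_
  · rintro _ _ ⟨a, rfl⟩ ⟨b, rfl⟩
    exact ⟨a + b, by simp [quadPoly, add_smul, Finset.sum_add_distrib]⟩
  · intro d hd
    have hdeg : d.degree = 2 := by
      rw [← hp (MvPolynomial.mem_support_iff.1 hd), Finsupp.degree_eq_weight_one]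
      rfl
    obtain ⟨j, hj⟩ : ∃ j, d j ≠ 0 := by
      by_contra! h
      obtain rfl : d = 0 := Finsupp.ext h
      simp at hdeg
    have hle : Finsupp.single j 1 ≤ d := Finsupp.single_le_iff.2 (Nat.one_le_iff_ne_zero.2 hj)
    obtain ⟨d', rfl⟩ := exists_add_of_le hle
    have hd' : d'.degree = 1 := by
      rw [map_add, Finsupp.degree_single] at hdeg
      omega
    obtain ⟨k, hk⟩ : ∃ k, d' k ≠ 0 := by
      by_contra! h
      obtain rfl : d' = 0 := Finsupp.ext h
      simp at hd'
    obtain ⟨d'', rfl⟩ := exists_add_of_le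
      (Finsupp.single_le_iff.2 (Nat.one_le_iff_ne_zero.2 hk) : Finsupp.single k 1 ≤ d')
    obtain rfl : d'' = 0 := (Finsupp.degree_eq_zero_iff _).1 (by
      rw [map_add, Finsupp.degree_single] at hd'
      omega)
    rw [add_zero]
    classical
    refine ⟨fun j' k' => if j' = j ∧ k' = k then
      p.coeff (Finsupp.single j 1 + Finsupp.single k 1) else 0, ?_⟩
    rw [quadPoly, Finset.sum_eq_single j, Finset.sum_eq_single k]
    · rw [if_pos ⟨rfl, rfl⟩, MvPolynomial.X, MvPolynomial.X, MvPolynomial.monomial_mul,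
        MvPolynomial.smul_monomial]
      simp
    · intro k' _ hk'
      rw [if_neg (by tauto), zero_smul]
    · simp
    · intro j' _ hj'
      exact Finset.sum_eq_zero fun k' _ => by rw [if_neg (by tauto), zero_smul]
    · simp

namespace ModTwoCohomology

open BarCochain

variable {W : Type*} [AddCommGroup W]

theorem bockstein_mkHom (z : cocycleAlgebra W) :
    bockstein (mkHom W z) = mkHom W ⟨bock z, z.2.1.bock, d_bock z.2.1 z.2.2⟩ := rfl

/-- The Bockstein on a product of two classes of degree one, read off from the
product of integral lifts. -/
theorem bockstein_dualClass_mul (x y : W →+ ZMod 2) :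
    bockstein (dualClass x * dualClass y) =
      dualClass x ^ 2 * dualClass y + dualClass x * dualClass y ^ 2 := by
  let X : cocycleAlgebra W := ⟨ofDual x, isBounded_ofDual x, d_ofDual x⟩
  let Y : cocycleAlgebra W := ⟨ofDual y, isBounded_ofDual y, d_ofDual y⟩
  have hR : dualClass x ^ 2 * dualClass y + dualClass x * dualClass y ^ 2 =
      mkHom W (X * (X * Y) + X * (Y * Y)) := by
    simp only [map_add, map_mul]
    change _ = dualClass x * (dualClass x * dualClass y) + dualClass x * (dualClass y * dualClass y)
    ring
  have hL : dualClass x * dualClass y = mkHom W (X * Y) := (map_mul (mkHom W) X Y).symm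
  rw [hR, hL, bockstein_mkHom]
  refine congrArg (mkHom W) (Subtype.ext ?_)
  change bock (ofDual x * ofDual y) =
    ofDual x * (ofDual x * ofDual y) + ofDual x * (ofDual y * ofDual y)
  ext l
  rw [BarCochain.add_apply]
  have h0 (a b c : W) (l : List W) : lift (ofDual x * ofDual y) (a :: b :: c :: l) = 0 := by
    simp [-mul_cons, lift, ofDual]
  have h1 (a : W) : lift (ofDual x * ofDual y) [a] = 0 := by simp [lift, ofDual]
  have h2 (a b : W) : lift (ofDual x * ofDual y) [a, b] = ((x a * y b).val : ℤ) := by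
    simp [lift, ofDual]
  match l with
  | [] => rfl
  | [a] => simp [bock, ofDual]
  | [a, b] => simp [bock, d_cons_cons, h1, ofDual]
  | [a, b, c] =>
    simp only [bock, d_cons_cons, shift_apply, d_singleton, h2, ofDual_mul_cons, map_add,
      ofDual]
    generalize x a = xa
    generalize x b = xb
    generalize y b = yb
    generalize y c = yc
    revert xa xb yb yc
    decide
  | a :: b :: c :: e :: l =>
    have h3 : shift c (shift b (shift a (lift (ofDual x * ofDual y)))) = 0 :=
      BarCochain.ext fun l => h0 a b c l
    have h4 : shift e (0 : BarCochain ℤ W) = 0 := rfl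
    cases l <;> simp [-mul_cons, bock, d_cons_cons, h0, h3, h4, d_zero, ofDual]

theorem bockstein_quadPoly {n : ℕ} (x : Fin n → W →+ ZMod 2) (a : Fin n → Fin n → ZMod 2) :
    bockstein (polyHom x (quadPoly a)) = polyHom x (quadDer a) := by
  simp only [quadPoly, quadDer, map_sum, map_smul, map_mul, map_add, map_pow, polyHom_X,
    ZMod.map_smul, bockstein_dualClass_mul]

end ModTwoCohomology

namespace CentralExtension

open BarCochain ModTwoCohomology

variable {V G W : Type*} [AddCommGroup V] [Module (ZMod 2) V] [Group G]
  [AddCommGroup W] [Module (ZMod 2) W] (E : CentralExtension V G W)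

/-- The quadratic map is the diagonal of the factor set. The constant `f(0, 0)` appears because
the section is not normalized at `0`. -/
theorem quadraticMap_eq (w : W) : E.quadraticMap w = E.factorSet w w + E.factorSet 0 0 := by
  have h0 : E.inl (Multiplicative.ofAdd (E.factorSet 0 0)) = E.sect 0 := by
    have h := E.factorSet_spec 0 0
    rw [add_zero] at h
    exact mul_right_cancel h
  apply Multiplicative.ofAdd.injective
  apply E.inl_injective
  rw [quadraticMap, (E.exists_square w).choose_spec _ (E.rightHom_sect w), ofAdd_add, map_mul, h0,
    pow_two, ← E.factorSet_spec, ZModModule.add_self]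

/-- The components of the extension class are the quadratic forms given by the components of the
quadratic map. -/
theorem exists_component_eq {n : ℕ} (c : Module.Basis (Fin n) (ZMod 2) W)
    (φ : Module.Dual (ZMod 2) V) : ∃ a : Fin n → Fin n → ZMod 2,
      E.component φ = polyHom (fun j => (c.coord j).toAddMonoidHom) (quadPoly a) ∧
      ∀ w, φ (E.quadraticMap w) = ∑ j, ∑ k, a j k * (c.repr w j * c.repr w k) := by
  have hhom : IsHomogeneous 2 (E.component φ) := by
    refine ⟨⟨E.factorCochain φ, E.factorCochain_mem φ⟩, ?_, rfl⟩
    ext l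
    rw [comp_apply]
    split
    · rfl
    · rename_i h
      exact (E.factorCochain_of_length_ne φ h).symm
  obtain ⟨p, hp, hpc⟩ := (isPolynomialOn_coord c).2 2 _ hhom
  obtain ⟨a, rfl⟩ := exists_eq_quadPoly hp
  refine ⟨a, hpc.symm, fun w => ?_⟩
  let x (j : Fin n) : cocycleAlgebra W := ⟨ofDual (c.coord j).toAddMonoidHom,
    isBounded_ofDual _, d_ofDual _⟩
  have h1 : polyHom (fun j => (c.coord j).toAddMonoidHom) (quadPoly a) =
      mkHom W (∑ j, ∑ k, a j k • (x j * x k)) := by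
    simp only [quadPoly, map_sum, map_smul, map_mul, polyHom_X]
    rfl
  have h2 : mkHom W (⟨E.factorCochain φ, E.factorCochain_mem φ⟩ -
      ∑ j, ∑ k, a j k • (x j * x k)) = 0 := by
    rw [map_sub, ← h1, hpc]
    exact sub_self _
  obtain ⟨u, -, hu⟩ := mkHom_eq_zero.1 h2
  -- A coboundary `d u` takes the value `u [0]` on every diagonal pair `[v, v]`, so the factor set
  -- and the quadratic form differ by a constant on the diagonal.
  have hev (v : W) : u [0] = φ (E.factorSet v v) - ∑ j, ∑ k, a j k * (c.repr v j * c.repr v k) := by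
    have h3 := congrFun hu [v, v]
    have h4 : d u [v, v] = u [0] := by
      rw [d_cons_cons_two, d_singleton, ZModModule.add_self]
      grind
    rw [← h4, h3]
    have h5 : ((∑ j, ∑ k, a j k • (x j * x k) : cocycleAlgebra W) : BarCochain (ZMod 2) W) [v, v] =
        ∑ j, ∑ k, a j k * (c.repr v j * c.repr v k) := by
      have h6 (f : cocycleAlgebra W →+ ZMod 2)
          (hf : ∀ z, f z = (z : BarCochain (ZMod 2) W) [v, v]) :
          f (∑ j, ∑ k, a j k • (x j * x k)) = ∑ j, ∑ k, a j k * (c.repr v j * c.repr v k) := by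
        simp only [map_sum]
        refine Finset.sum_congr rfl fun j _ => Finset.sum_congr rfl fun k _ => ?_
        rw [hf]
        change a j k * (ofDual (c.coord j).toAddMonoidHom * ofDual (c.coord k).toAddMonoidHom :
          BarCochain (ZMod 2) W) [v, v] = _
        rw [ofDual_mul_cons]
        rfl
      exact h6 ⟨⟨fun z => (z : BarCochain (ZMod 2) W) [v, v], rfl⟩, fun _ _ => rfl⟩ fun _ => rfl
    rw [← h5]
    rfl
  have h7 := hev w
  have h8 := hev 0
  simp only [map_zero, Finsupp.coe_zero, Pi.zero_apply, mul_zero, Finset.sum_const_zero,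
    sub_zero] at h8
  rw [quadraticMap_eq, map_add, ← h8, h7]
  grind

end CentralExtension

/-! ### Common zeros of Bockstein closed quadrics -/

section ZeroLocus

variable {n : ℕ} {L : Type*} [Field L] [Algebra (ZMod 2) L]

/-- The bilinear form `∑ aⱼₖ uⱼ vₖ` over a field of characteristic two. -/
def quadBilin (a : Fin n → Fin n → ZMod 2) (u v : Fin n → L) : L :=
  ∑ j, ∑ k, a j k • (u j * v k)

theorem quadBilin_add_left (a : Fin n → Fin n → ZMod 2) (u u' v : Fin n → L) :
    quadBilin a (u + u') v = quadBilin a u v + quadBilin a u' v := by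
  simp [quadBilin, add_mul, Finset.sum_add_distrib]

theorem quadBilin_add_right (a : Fin n → Fin n → ZMod 2) (u v v' : Fin n → L) :
    quadBilin a u (v + v') = quadBilin a u v + quadBilin a u v' := by
  simp [quadBilin, mul_add, Finset.sum_add_distrib]

theorem quadBilin_smul_left (a : Fin n → Fin n → ZMod 2) (r : L) (u v : Fin n → L) :
    quadBilin a (r • u) v = r * quadBilin a u v := by
  simp [quadBilin, Finset.mul_sum, mul_assoc]

theorem quadBilin_smul_right (a : Fin n → Fin n → ZMod 2) (r : L) (u v : Fin n → L) :
    quadBilin a u (r • v) = r * quadBilin a u v := by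
  simp [quadBilin, Finset.mul_sum, mul_left_comm]

theorem quadBilin_pow (a : Fin n → Fin n → ZMod 2) (m : ℕ) (u v : Fin n → L) :
    quadBilin a (u ^ 2 ^ m) (v ^ 2 ^ m) = quadBilin a u v ^ 2 ^ m := by
  have : CharP L 2 := charP_of_injective_algebraMap (algebraMap (ZMod 2) L).injective 2
  simp only [quadBilin, sum_pow_char_pow, Pi.pow_apply]
  refine Finset.sum_congr rfl fun j _ => Finset.sum_congr rfl fun k _ => ?_
  rw [smul_pow, mul_pow]
  congr 1
  have h (t : ZMod 2) : t ^ 2 ^ m = t := by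
    have := ZMod.pow_card_pow (p := 2) (n := m) t
    exact this
  exact (h _).symm

theorem aeval_quadPoly (a : Fin n → Fin n → ZMod 2) (u : Fin n → L) :
    MvPolynomial.aeval u (quadPoly a) = quadBilin a u u := by
  simp [quadPoly, quadBilin]

theorem aeval_quadDer (a : Fin n → Fin n → ZMod 2) (u : Fin n → L) :
    MvPolynomial.aeval u (quadDer a) = quadBilin a (u ^ 2) u + quadBilin a u (u ^ 2) := by
  simp [quadDer, quadBilin, Finset.sum_add_distrib]

/-- If the common zeros of the quadratic forms `quadPoly (a i)` are zeros of the `quadDer (a i)`,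
then the polar forms vanish on every pair `(u, u ^ 2 ^ m)` with `u` a common zero. The set of
common zeros is stable under `u ↦ u + u ^ 2`, and comparing `u` with `u + u ^ 2` raises `m`. -/
theorem polar_frobenius_eq_zero {ι : Type*} {a : ι → Fin n → Fin n → ZMod 2}
    (hD : ∀ u : Fin n → L, (∀ i, quadBilin (a i) u u = 0) →
      ∀ i, quadBilin (a i) (u ^ 2) u + quadBilin (a i) u (u ^ 2) = 0)
    (m : ℕ) (u : Fin n → L) (hu : ∀ i, quadBilin (a i) u u = 0) (i : ι) :
    quadBilin (a i) u (u ^ 2 ^ m) + quadBilin (a i) (u ^ 2 ^ m) u = 0 := by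
  have : CharP L 2 := charP_of_injective_algebraMap (algebraMap (ZMod 2) L).injective 2
  induction m using Nat.strong_induction_on generalizing u with
  | _ m ih =>
    match m with
    | 0 => simp [hu]
    | 1 =>
      rw [add_comm]
      simpa using hD u hu i
    | m + 2 =>
      have hF (k : ℕ) : u ^ 2 ^ (k + 1) = (u ^ 2) ^ 2 ^ k := by rw [← pow_mul, pow_succ']
      have hF' (k : ℕ) : u ^ 2 ^ (k + 1) = (u ^ 2 ^ k) ^ 2 := by rw [← pow_mul, pow_succ]
      have hp (v w : Fin n → L) (i : ι) :
          quadBilin (a i) (v ^ 2) (w ^ 2) = quadBilin (a i) v w ^ 2 := by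
        simpa using quadBilin_pow (a i) 1 v w
      have hb : ∀ i, quadBilin (a i) (u + u ^ 2) (u + u ^ 2) = 0 := by
        intro i
        rw [quadBilin_add_left, quadBilin_add_right, quadBilin_add_right, hp, hu]
        have := hD u hu i
        linear_combination this
      have hbp : (u + u ^ 2) ^ 2 ^ (m + 1) = u ^ 2 ^ (m + 1) + u ^ 2 ^ (m + 2) := by
        ext j
        simp only [Pi.pow_apply, Pi.add_apply]
        rw [add_pow_char_pow, ← pow_mul, ← pow_succ']
      have h1 := ih (m + 1) (by omega) (u + u ^ 2) hb
      have h2 := ih (m + 1) (by omega) u hu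
      have h3 := ih m (by omega) u hu
      have h4 : quadBilin (a i) (u ^ 2) (u ^ 2 ^ (m + 1)) +
          quadBilin (a i) (u ^ 2 ^ (m + 1)) (u ^ 2) = 0 := by
        rw [hF', hp, hp, ← add_pow_char, h3, zero_pow two_ne_zero]
      have h5 : quadBilin (a i) (u ^ 2) (u ^ 2 ^ (m + 2)) +
          quadBilin (a i) (u ^ 2 ^ (m + 2)) (u ^ 2) = 0 := by
        rw [show u ^ 2 ^ (m + 2) = (u ^ 2 ^ (m + 1)) ^ 2 by rw [← pow_mul, ← pow_succ], hp, hp,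
          ← add_pow_char, h2, zero_pow two_ne_zero]
      rw [hbp] at h1
      simp only [quadBilin_add_left, quadBilin_add_right] at h1
      linear_combination h1 - h2 - h4 - h5

/-- In the situation of `polar_frobenius_eq_zero`, the forms vanish on the span of the
Frobenius conjugates of a common zero. -/
theorem quadBilin_sum_frobenius_eq_zero {ι : Type*} {a : ι → Fin n → Fin n → ZMod 2}
    (hD : ∀ u : Fin n → L, (∀ i, quadBilin (a i) u u = 0) →
      ∀ i, quadBilin (a i) (u ^ 2) u + quadBilin (a i) u (u ^ 2) = 0)
    (u : Fin n → L) (hu : ∀ i, quadBilin (a i) u u = 0) (c : ℕ → L) (d : ℕ) (i : ι) :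
    quadBilin (a i) (∑ k ∈ Finset.range d, c k • u ^ 2 ^ k)
      (∑ k ∈ Finset.range d, c k • u ^ 2 ^ k) = 0 := by
  have : CharP L 2 := charP_of_injective_algebraMap (algebraMap (ZMod 2) L).injective 2
  have hpol (d m : ℕ) (hd : d ≤ m) :
      quadBilin (a i) (∑ k ∈ Finset.range d, c k • u ^ 2 ^ k) (u ^ 2 ^ m) +
      quadBilin (a i) (u ^ 2 ^ m) (∑ k ∈ Finset.range d, c k • u ^ 2 ^ k) = 0 := by
    induction d with
    | zero => simp [quadBilin]
    | succ d ih =>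
      have h := polar_frobenius_eq_zero hD (m - d) u hu i
      have h' : quadBilin (a i) (u ^ 2 ^ d) (u ^ 2 ^ m) +
          quadBilin (a i) (u ^ 2 ^ m) (u ^ 2 ^ d) = 0 := by
        have hm : u ^ 2 ^ m = (u ^ 2 ^ (m - d)) ^ 2 ^ d := by
          rw [← pow_mul, ← pow_add, Nat.sub_add_cancel (by omega)]
        rw [hm, quadBilin_pow, quadBilin_pow, ← add_pow_char_pow, h, zero_pow (by positivity)]
      rw [Finset.sum_range_succ, quadBilin_add_left, quadBilin_add_right, quadBilin_smul_left,
        quadBilin_smul_right]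
      linear_combination ih (by omega) + c d * h'
  induction d with
  | zero => simp [quadBilin]
  | succ d ih =>
    rw [Finset.sum_range_succ]
    simp only [quadBilin_add_left, quadBilin_add_right, quadBilin_smul_left, quadBilin_smul_right]
    rw [ih, quadBilin_pow, hu, zero_pow (by positivity)]
    linear_combination c d * hpol d d le_rfl

/-- An ideal generated by quadratic forms over `𝔽₂` that is closed under the derivation
`Xⱼ ↦ Xⱼ²` and has no nonzero zero over `𝔽₂` has the irrelevant ideal as its radical. At a closed
point with residue field `L`, a nonzero coordinate `u j` has some `b` with `Tr (u j * b) ≠ 0`,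
and `(Tr (u k * b))ₖ` is then a nonzero zero over `𝔽₂`. -/
theorem X_mem_radical_span_quadPoly {ι : Type*} {a : ι → Fin n → Fin n → ZMod 2}
    (hD : ∀ i, quadDer (a i) ∈ Ideal.span (Set.range fun i => quadPoly (a i)))
    (h0 : ∀ w : Fin n → ZMod 2, (∀ i, quadBilin (a i) w w = 0) → w = 0) (j : Fin n) :
    MvPolynomial.X j ∈ (Ideal.span (Set.range fun i => quadPoly (a i))).radical := by
  rw [Ideal.radical_eq_jacobson, Ideal.jacobson, Ideal.mem_sInf]
  rintro M ⟨hJM, hM⟩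
  let := Ideal.Quotient.field M
  let L := MvPolynomial (Fin n) (ZMod 2) ⧸ M
  have : Module.Finite (ZMod 2) L := finite_of_finite_type_of_isJacobsonRing (ZMod 2) L
  have : Finite L := Module.finite_of_finite (ZMod 2)
  let u : Fin n → L := fun k => Ideal.Quotient.mk M (MvPolynomial.X k)
  have hu (p : MvPolynomial (Fin n) (ZMod 2)) : MvPolynomial.aeval u p = Ideal.Quotient.mk M p := by
    have h : MvPolynomial.aeval u = Ideal.Quotient.mkₐ (ZMod 2) M :=
      MvPolynomial.algHom_ext fun k => by rw [MvPolynomial.aeval_X]; rfl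
    rw [h]
    rfl
  have hzero (i : ι) : quadBilin (a i) u u = 0 := by
    rw [← aeval_quadPoly, hu]
    exact Ideal.Quotient.eq_zero_iff_mem.2 (hJM (Ideal.subset_span ⟨i, rfl⟩))
  have hD' (v : Fin n → L) (hv : ∀ i, quadBilin (a i) v v = 0) (i : ι) :
      quadBilin (a i) (v ^ 2) v + quadBilin (a i) v (v ^ 2) = 0 := by
    rw [← aeval_quadDer]
    have hle : Ideal.span (Set.range fun i => quadPoly (a i)) ≤
        RingHom.ker (MvPolynomial.aeval v : MvPolynomial (Fin n) (ZMod 2) →ₐ[ZMod 2] L) := by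
      rw [Ideal.span_le]
      rintro _ ⟨i, rfl⟩
      exact (aeval_quadPoly _ _).trans (hv i)
    exact hle (hD i)
  by_contra hj
  have huj : u j ≠ 0 := fun h => hj (Ideal.Quotient.eq_zero_iff_mem.1 h)
  obtain ⟨b, hb⟩ : ∃ b : L, Algebra.trace (ZMod 2) L (u j * b) ≠ 0 := by
    by_contra! h
    exact huj ((traceForm_nondegenerate (ZMod 2) L).1 _ fun b => h b)
  refine hb (congrFun (h0 (fun k => Algebra.trace (ZMod 2) L (u k * b)) fun i => ?_) j)
  have h1 : algebraMap (ZMod 2) L (quadBilin (a i) (fun k => Algebra.trace (ZMod 2) L (u k * b))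
      fun k => Algebra.trace (ZMod 2) L (u k * b)) = quadBilin (a i)
      (∑ k ∈ Finset.range (Module.finrank (ZMod 2) L), b ^ 2 ^ k • u ^ 2 ^ k)
      (∑ k ∈ Finset.range (Module.finrank (ZMod 2) L), b ^ 2 ^ k • u ^ 2 ^ k) := by
    have h2 (k : Fin n) : (∑ m ∈ Finset.range (Module.finrank (ZMod 2) L),
        b ^ 2 ^ m • u ^ 2 ^ m) k = algebraMap (ZMod 2) L (Algebra.trace (ZMod 2) L (u k * b)) := by
      rw [FiniteField.algebraMap_trace_eq_sum_pow, Finset.sum_apply, Nat.card_zmod]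
      exact Finset.sum_congr rfl fun m _ => by
        rw [mul_pow, mul_comm]
        rfl
    simp only [quadBilin, h2, map_sum]
    refine Finset.sum_congr rfl fun k _ => Finset.sum_congr rfl fun l _ => ?_
    rw [smul_eq_mul, map_mul, map_mul, Algebra.smul_def]
  rw [quadBilin_sum_frobenius_eq_zero hD' u hzero, map_eq_zero_iff _
    (algebraMap (ZMod 2) L).injective] at h1
  exact h1

end ZeroLocus

/-! ### Systems of parameters are regular sequences -/

section Exchange

open IsLocalRing RingTheory.Sequence Module

variable {R : Type*} [CommRing R] [IsNoetherianRing R] [IsLocalRing R]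

theorem supportDim_quotSMulTop_comm {R M : Type*} [CommRing R] [AddCommGroup M] [Module R M]
    [Module.Finite R M] (x y : R) :
    supportDim R (QuotSMulTop x (QuotSMulTop y M)) =
      supportDim R (QuotSMulTop y (QuotSMulTop x M)) := by
  have h : support R (QuotSMulTop x (QuotSMulTop y M)) =
      support R (QuotSMulTop y (QuotSMulTop x M)) := by
    simp only [support_quotSMulTop]
    rw [Set.inter_right_comm]
  rw [supportDim, supportDim, h]

/-- Cutting by an element outside all nonmaximal minimal primes lowers the dimension, unless the
dimension is zero already. -/
theorem supportDim_quotSMulTop_le {N : Type*} [AddCommGroup N] [Module R N] [Module.Finite R N]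
    {z : R} (hz : ∀ p ∈ (annihilator R N).minimalPrimes, p ≠ maximalIdeal R → z ∉ p) {e : ℕ}
    (he : supportDim R N ≤ (e + 1 : ℕ)) : supportDim R (QuotSMulTop z N) ≤ e := by
  by_cases hm : maximalIdeal R ∈ (annihilator R N).minimalPrimes
  · have h0 : supportDim R N ≤ 0 := by
      have hsub : Subsingleton (support R N) := by
        refine ⟨fun p q => Subtype.ext (PrimeSpectrum.ext ?_)⟩
        have h (p : support R N) : p.1.1 = maximalIdeal R :=
          le_antisymm (le_maximalIdeal p.1.2.ne_top)
            (hm.2 ⟨p.1.2, mem_support_iff_of_finite.1 p.2⟩ (le_maximalIdeal p.1.2.ne_top))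
        rw [h p, h q]
      exact Order.krullDim_nonpos_of_subsingleton
    refine (supportDim_le_of_surjective (Submodule.mkQ _) (Submodule.mkQ_surjective _)).trans
      (h0.trans ?_)
    exact_mod_cast Nat.zero_le e
  · have h := (supportDim_quotSMulTop_succ_le_of_notMem_minimalPrimes (M := N) (x := z)
      fun p hp => hz p hp fun h => hm (h ▸ hp)).trans he
    rw [Nat.cast_add, Nat.cast_one] at h
    exact ENat.WithBot.add_le_add_one_right_iff.1 h

theorem supportDim_le_add_length {N : Type*} [AddCommGroup N] [Module R N] [Module.Finite R N]
    (ys : List R) (hys : ∀ y ∈ ys, y ∈ maximalIdeal R)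
    (h0 : supportDim R (N ⧸ (Ideal.ofList ys • ⊤ : Submodule R N)) ≤ 0) :
    supportDim R N ≤ ys.length := by
  induction ys generalizing N with
  | nil =>
    refine le_trans (supportDim_eq_of_equiv (Submodule.quotEquivOfEqBot _ ?_)).symm.le h0
    rw [Ideal.ofList_nil, Submodule.bot_smul]
  | cons y ys ih =>
    have h1 := ih (N := QuotSMulTop y N) (fun z hz => hys z (List.mem_cons_of_mem _ hz))
      ((supportDim_eq_of_equiv
        (Submodule.quotOfListConsSMulTopEquivQuotSMulTopInner N y ys)).symm.le.trans h0)
    refine (supportDim_le_supportDim_quotSMulTop_succ (hys y List.mem_cons_self)).trans ?_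
    rw [List.length_cons, Nat.cast_add, Nat.cast_one]
    gcongr

/-- If `M` has a regular sequence of length `d + 1` and `M / yM` has dimension at most `d`, then
`y` is the beginning of a regular sequence of length `d + 1`. -/
theorem exists_isWeaklyRegular_cons (d : ℕ) {M : Type*} [AddCommGroup M] [Module R M]
    [Module.Finite R M] (rs : List R) (hlen : rs.length = d + 1)
    (hrs : ∀ r ∈ rs, r ∈ maximalIdeal R) (hreg : IsWeaklyRegular M rs) (y : R)
    (hy : y ∈ maximalIdeal R) (hdim : supportDim R (QuotSMulTop y M) ≤ d) :
    ∃ rs' : List R, rs'.length = d ∧ (∀ r ∈ rs', r ∈ maximalIdeal R) ∧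
      IsWeaklyRegular M (y :: rs') := by
  induction d generalizing M rs y with
  | zero =>
    obtain ⟨x, rfl⟩ := List.length_eq_one_iff.1 hlen
    rw [isWeaklyRegular_singleton_iff] at hreg
    refine ⟨[], rfl, by simp, (isWeaklyRegular_singleton_iff M y).2 ?_⟩
    -- A zero divisor `y` lies in an associated prime, which does not contain `x`
    -- and so is not maximal, but lies in the support of `M / yM`.
    by_contra hny
    have hny' : y ∈ ⋃ p ∈ associatedPrimes R M, (p : Set R) := by
      rw [biUnion_associatedPrimes_eq_compl_regular]
      exact hny
    simp only [Set.mem_iUnion] at hny'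
    obtain ⟨p, hp, hyp⟩ := hny'
    have hxp : x ∉ p := fun hxp => by
      have : x ∈ ⋃ p ∈ associatedPrimes R M, (p : Set R) := Set.mem_biUnion hp hxp
      rw [biUnion_associatedPrimes_eq_compl_regular] at this
      exact this hreg
    let P : PrimeSpectrum R := ⟨p, hp.isPrime⟩
    let m : PrimeSpectrum R := ⟨maximalIdeal R, inferInstance⟩
    have hP : P ∈ support R (QuotSMulTop y M) := by
      rw [support_quotSMulTop]
      exact ⟨mem_support_iff_of_finite.2
        ((Submodule.annihilator_top (R := R) (M := M)).symm.le.trans hp.annihilator_le),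
        by simpa using hyp⟩
    have hle : P ≤ m := le_maximalIdeal hp.isPrime.ne_top
    have hm : m ∈ support R (QuotSMulTop y M) := mem_support_mono hle hP
    have hlt : (⟨P, hP⟩ : support R (QuotSMulTop y M)) < ⟨m, hm⟩ :=
      lt_of_le_of_ne hle fun h => hxp (by
        have h1 : p = maximalIdeal R := congrArg (fun q => q.1.1) h
        rw [h1]
        exact hrs x (by simp))
    have := Order.krullDim_pos_iff.2 ⟨_, _, hlt⟩
    exact absurd hdim (not_le.2 this)
  | succ d ih =>
    obtain ⟨x, rs, rfl⟩ := List.exists_cons_of_length_eq_add_one hlen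
    have hx := hrs x List.mem_cons_self
    obtain ⟨hxreg, hreg'⟩ := (isWeaklyRegular_cons_iff M x rs).1 hreg
    have hdimM : supportDim R M ≤ (d + 1 : ℕ) + 1 :=
      (supportDim_le_supportDim_quotSMulTop_succ hy).trans (by gcongr)
    have hdimx : supportDim R (QuotSMulTop x M) ≤ (d + 1 : ℕ) := by
      rw [← supportDim_quotSMulTop_succ_eq_supportDim hxreg hx] at hdimM
      exact ENat.WithBot.add_le_add_one_right_iff.1 hdimM
    -- Prime avoidance gives `z` that cuts down both quotients.
    obtain ⟨z, hz, hzx, hzy⟩ : ∃ z ∈ maximalIdeal R,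
        (∀ p ∈ (annihilator R (QuotSMulTop x M)).minimalPrimes, p ≠ maximalIdeal R → z ∉ p) ∧
        (∀ p ∈ (annihilator R (QuotSMulTop y M)).minimalPrimes, p ≠ maximalIdeal R → z ∉ p) := by
      let T : Set (Ideal R) := ((annihilator R (QuotSMulTop x M)).minimalPrimes ∪
        (annihilator R (QuotSMulTop y M)).minimalPrimes) \ {maximalIdeal R}
      have hT : T.Finite := ((Ideal.finite_minimalPrimes_of_isNoetherianRing R _).union
        (Ideal.finite_minimalPrimes_of_isNoetherianRing R _)).sdiff
      have hTp : ∀ p ∈ T, p.IsPrime := by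
        rintro p ⟨hp | hp, -⟩ <;> exact hp.1.1
      have hnot : ¬ (maximalIdeal R : Set R) ⊆ ⋃ p ∈ T, (p : Set R) := by
        intro h
        obtain ⟨p, hp, hle⟩ := (Ideal.subset_union_prime_finite hT (f := id) ⊥ ⊥
          fun p hp _ _ => hTp p hp).1 h
        exact hp.2 (le_antisymm (le_maximalIdeal (hTp p hp).ne_top) hle)
      obtain ⟨z, hz, hzT⟩ := Set.not_subset.1 hnot
      simp only [Set.mem_iUnion, not_exists] at hzT
      exact ⟨z, hz, fun p hp hpm => hzT p ⟨Or.inl hp, hpm⟩, fun p hp hpm => hzT p ⟨Or.inr hp, hpm⟩⟩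
    obtain ⟨rs₁, hlen₁, hrs₁, hreg₁⟩ := ih (M := QuotSMulTop x M) rs (by simpa using hlen)
      (fun r hr => hrs r (List.mem_cons_of_mem _ hr)) hreg' z hz
      (supportDim_quotSMulTop_le hzx hdimx)
    have hreg₂ : IsWeaklyRegular M (z :: x :: rs₁) :=
      IsLocalRing.isWeaklyRegular_of_perm_of_subset_maximalIdeal
        ((isWeaklyRegular_cons_iff M x _).2 ⟨hxreg, hreg₁⟩) (List.Perm.swap z x rs₁)
        (List.forall_mem_cons.2 ⟨hx, List.forall_mem_cons.2 ⟨hz, hrs₁⟩⟩)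
    obtain ⟨hzreg, hreg₃⟩ := (isWeaklyRegular_cons_iff M z _).1 hreg₂
    obtain ⟨rs₂, hlen₂, hrs₂, hreg₄⟩ := ih (M := QuotSMulTop z M) (x :: rs₁) (by simpa using hlen₁)
      (List.forall_mem_cons.2 ⟨hx, hrs₁⟩) hreg₃ y hy (by
        rw [supportDim_quotSMulTop_comm]
        exact supportDim_quotSMulTop_le hzy hdim)
    exact ⟨z :: rs₂, by simpa using hlen₂, List.forall_mem_cons.2 ⟨hz, hrs₂⟩,
      IsLocalRing.isWeaklyRegular_of_perm_of_subset_maximalIdeal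
        ((isWeaklyRegular_cons_iff M z _).2 ⟨hzreg, hreg₄⟩) (List.Perm.swap y z rs₂)
        (List.forall_mem_cons.2 ⟨hz, List.forall_mem_cons.2 ⟨hy, hrs₂⟩⟩)⟩

/-- If a module has a regular sequence of length `d`, then every system of `d` parameters is a
regular sequence. -/
theorem isWeaklyRegular_of_supportDim_nonpos {M : Type*} [AddCommGroup M] [Module R M]
    [Module.Finite R M] (rs ys : List R) (hlen : rs.length = ys.length)
    (hrs : ∀ r ∈ rs, r ∈ maximalIdeal R) (hreg : IsWeaklyRegular M rs)
    (hys : ∀ y ∈ ys, y ∈ maximalIdeal R)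
    (hdim : supportDim R (M ⧸ (Ideal.ofList ys • ⊤ : Submodule R M)) ≤ 0) :
    IsWeaklyRegular M ys := by
  induction ys generalizing M rs with
  | nil => exact IsWeaklyRegular.nil R M
  | cons y ys ih =>
    have hys' : ∀ y ∈ ys, y ∈ maximalIdeal R := fun z hz => hys z (List.mem_cons_of_mem _ hz)
    have hdim' := (supportDim_eq_of_equiv
      (Submodule.quotOfListConsSMulTopEquivQuotSMulTopInner M y ys)).symm.le.trans hdim
    obtain ⟨rs', hlen', hrs', hreg'⟩ := exists_isWeaklyRegular_cons ys.length rs hlen hrs hreg y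
      (hys y List.mem_cons_self) (supportDim_le_add_length ys hys' hdim')
    obtain ⟨hyreg, hreg''⟩ := (isWeaklyRegular_cons_iff M y rs').1 hreg'
    exact (isWeaklyRegular_cons_iff M y ys).2 ⟨hyreg, ih rs' hlen' hrs' hreg'' hys' hdim'⟩

end Exchange

/-! ### Homogeneous parameters in a polynomial ring -/

section HomogeneousParameters

open RingTheory.Sequence MvPolynomial

attribute [local instance] MvPolynomial.gradedAlgebra

variable {K : Type*} [Field K] {n : ℕ}

theorem mem_idealOfVars_iff_constantCoeff {p : MvPolynomial (Fin n) K} :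
    p ∈ idealOfVars (Fin n) K ↔ constantCoeff p = 0 := by
  rw [← pow_one (idealOfVars (Fin n) K), mem_pow_idealOfVars_iff']
  constructor
  · intro h
    exact h 0 (by simp)
  · intro h d hd
    obtain rfl : d = 0 := (Finsupp.degree_eq_zero_iff _).1 (by omega)
    exact h

instance isMaximal_idealOfVars : (idealOfVars (Fin n) K).IsMaximal := by
  have h : idealOfVars (Fin n) K = RingHom.ker (constantCoeff : MvPolynomial (Fin n) K →+* K) :=
    Ideal.ext fun p => mem_idealOfVars_iff_constantCoeff
  rw [h]
  exact RingHom.ker_isMaximal_of_surjective _ fun r => ⟨C r, constantCoeff_C _ r⟩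

/-- Homogeneous ideals are saturated with respect to polynomials with nonzero constant term. -/
theorem mem_of_mul_mem_of_constantCoeff_ne_zero {J : Ideal (MvPolynomial (Fin n) K)}
    (hJ : J.IsHomogeneous (homogeneousSubmodule (Fin n) K)) {s u : MvPolynomial (Fin n) K}
    (hs : constantCoeff s ≠ 0) (hsu : s * u ∈ J) : u ∈ J := by
  -- Modulo `J`, multiplication by `1 - s / s(0)` fixes `u`, so `u` lies in `J` up to terms of
  -- arbitrarily high order.
  have hk (k : ℕ) : ∃ t ∈ idealOfVars (Fin n) K ^ k, u - t ∈ J := by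
    induction k with
    | zero => exact ⟨u, by simp, by simp⟩
    | succ k ih =>
      obtain ⟨t, ht, hut⟩ := ih
      let s' := 1 - C (constantCoeff s)⁻¹ * s
      have hs' : s' ∈ idealOfVars (Fin n) K := by
        rw [mem_idealOfVars_iff_constantCoeff]
        simp [s', hs]
      refine ⟨s' * t, by rw [pow_succ']; exact Ideal.mul_mem_mul hs' ht, ?_⟩
      have h : u - s' * t = C (constantCoeff s)⁻¹ * (s * u) + s' * (u - t) := by
        simp only [s']
        ring
      rw [h]
      exact J.add_mem (J.mul_mem_left _ hsu) (J.mul_mem_left _ hut)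
  rw [mem_iff_homogeneousComponent_mem hJ]
  intro d
  obtain ⟨t, ht, hut⟩ := hk (d + 1)
  have h0 : homogeneousComponent d t = 0 := by
    ext e
    rw [coeff_homogeneousComponent, coeff_zero]
    split
    · rename_i he
      exact (mem_pow_idealOfVars_iff' _ _).1 ht _ (by omega)
    · rfl
  have h := homogeneousComponent_mem_of_mem hJ hut d
  rwa [map_sub, h0, sub_zero] at h

theorem isWeaklyRegular_X :
    IsWeaklyRegular (MvPolynomial (Fin n) K) (List.ofFn (X : Fin n → MvPolynomial (Fin n) K)) := by
  rw [isWeaklyRegular_iff]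
  intro i hi
  rw [List.length_ofFn] at hi
  have hJ : (Ideal.ofList ((List.ofFn (X : Fin n → MvPolynomial (Fin n) K)).take i) • ⊤ :
      Ideal (MvPolynomial (Fin n) K)) = Ideal.span (X '' {j : Fin n | j.1 < i}) := by
    rw [smul_eq_mul, Ideal.mul_top, Ideal.ofList]
    congr 1
    ext p
    simp only [Set.mem_ofPred_eq, List.mem_take_iff_getElem, List.getElem_ofFn, List.length_ofFn,
      Set.mem_image]
    constructor
    · rintro ⟨j, hj, rfl⟩
      exact ⟨⟨j, by omega⟩, by simp; omega, rfl⟩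
    · rintro ⟨j, hj, rfl⟩
      exact ⟨j, by omega, rfl⟩
  rw [hJ, isSMulRegular_quotient_iff_mem_of_smul_mem]
  intro u hu
  rw [mem_ideal_span_X_image] at hu ⊢
  intro m hm
  rw [List.getElem_ofFn, smul_eq_mul] at hu
  obtain ⟨j, hj, hmj⟩ := hu (Finsupp.single ⟨i, hi⟩ 1 + m) (by
    rw [mem_support_iff, coeff_X_mul]
    exact mem_support_iff.1 hm)
  refine ⟨j, hj, ?_⟩
  rw [Finsupp.add_apply, Finsupp.single_eq_of_ne, zero_add] at hmj
  · exact hmj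
  · rintro rfl
    exact absurd hj (lt_irrefl i)

/-- A homogeneous system of parameters of a polynomial ring is a regular sequence. -/
theorem isRegular_of_X_mem_radical {q : Fin n → MvPolynomial (Fin n) K} {e : ℕ} (he : e ≠ 0)
    (hq : ∀ i, (q i).IsHomogeneous e)
    (hrad : ∀ j, X j ∈ (Ideal.span (Set.range q)).radical) :
    IsRegular (MvPolynomial (Fin n) K) (List.ofFn q) := by
  have hqm (i) : q i ∈ idealOfVars (Fin n) K := by
    rw [mem_idealOfVars_iff_constantCoeff]
    exact (hq i).coeff_eq_zero (by simpa using he.symm)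
  -- Regularity holds in the local ring at the origin, where the variables form a regular sequence.
  let R := Localization.AtPrime (idealOfVars (Fin n) K)
  have : IsNoetherianRing R := IsLocalization.isNoetherianRing
    (idealOfVars (Fin n) K).primeCompl R inferInstance
  have hmem (p : MvPolynomial (Fin n) K) (hp : p ∈ idealOfVars (Fin n) K) :
      algebraMap _ R p ∈ IsLocalRing.maximalIdeal R :=
    (IsLocalization.AtPrime.to_map_mem_maximal_iff R (idealOfVars (Fin n) K) p).2 hp
  have hofList : Ideal.ofList (List.ofFn q) = Ideal.span (Set.range q) := by
    rw [Ideal.ofList]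
    congr 1
    ext p
    simp [List.mem_ofFn]
  have hloc : IsWeaklyRegular R ((List.ofFn q).map (algebraMap _ R)) := by
    refine isWeaklyRegular_of_supportDim_nonpos
      ((List.ofFn (X : Fin n → MvPolynomial (Fin n) K)).map (algebraMap _ R)) _ (by simp) ?_
      (isWeaklyRegular_X.of_isLocalization R (idealOfVars (Fin n) K).primeCompl) ?_ ?_
    · simp only [List.mem_map, List.mem_ofFn]
      rintro _ ⟨_, ⟨j, rfl⟩, rfl⟩
      exact hmem _ (Ideal.subset_span ⟨j, rfl⟩)
    · simp only [List.mem_map, List.mem_ofFn]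
      rintro _ ⟨_, ⟨j, rfl⟩, rfl⟩
      exact hmem _ (hqm j)
    · rw [← Ideal.map_ofList, hofList]
      have hsub : Subsingleton (Module.support R (R ⧸ ((Ideal.span (Set.range q)).map
          (algebraMap _ R) • ⊤ : Submodule R R))) := by
        refine ⟨fun P Q => Subtype.ext (PrimeSpectrum.ext ?_)⟩
        have h (P : Module.support R (R ⧸ ((Ideal.span (Set.range q)).map
          (algebraMap _ R) • ⊤ : Submodule R R))) : P.1.1 = IsLocalRing.maximalIdeal R := by
          have hP := Module.mem_support_iff_of_finite.1 P.2
          rw [Ideal.annihilator_quotient] at hP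
          replace hP := (Ideal.mul_top _).ge.trans hP
          rw [Ideal.map_le_iff_le_comap] at hP
          refine le_antisymm (IsLocalRing.le_maximalIdeal P.1.2.ne_top) ?_
          rw [← Localization.AtPrime.map_eq_maximalIdeal, Ideal.map_le_iff_le_comap]
          refine Ideal.span_le.2 ?_
          rintro _ ⟨j, rfl⟩
          have := P.1.2
          exact (Ideal.IsPrime.radical_le_iff inferInstance).2 hP (hrad j)
        rw [h P, h Q]
      exact Order.krullDim_nonpos_of_subsingleton
  -- Denominators are removed by homogeneity.
  refine ⟨(isWeaklyRegular_iff _ _).2 fun i hi => ?_, ?_⟩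
  · have hreg := (isWeaklyRegular_iff _ _).1 hloc i (by simpa using hi)
    rw [isSMulRegular_quotient_iff_mem_of_smul_mem] at hreg ⊢
    intro u hu
    rw [smul_eq_mul, Ideal.mul_top] at hu ⊢
    have h1 := hreg (algebraMap _ R u) (by
      rw [smul_eq_mul (a := Ideal.ofList _), Ideal.mul_top, ← List.map_take, ← Ideal.map_ofList,
        List.getElem_map, smul_eq_mul, ← map_mul]
      exact Ideal.mem_map_of_mem _ hu)
    rw [smul_eq_mul, Ideal.mul_top, ← List.map_take, ← Ideal.map_ofList,
      IsLocalization.algebraMap_mem_map_algebraMap_iff (idealOfVars (Fin n) K).primeCompl] at h1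
    obtain ⟨s, hs, hsu⟩ := h1
    refine mem_of_mul_mem_of_constantCoeff_ne_zero ?_
      (fun h => hs (mem_idealOfVars_iff_constantCoeff.2 h)) hsu
    refine Ideal.homogeneous_span _ _ fun p hp => ⟨e, ?_⟩
    obtain ⟨j, rfl⟩ := List.mem_ofFn.1 (List.mem_of_mem_take hp)
    exact hq j
  · rw [smul_eq_mul, Ideal.mul_top, hofList]
    intro h
    refine (isMaximal_idealOfVars (K := K) (n := n)).ne_top (top_le_iff.1 (h.le.trans ?_))
    rw [Ideal.span_le]
    rintro _ ⟨i, rfl⟩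
    exact hqm i

end HomogeneousParameters

/-! ### Freeness over the algebra of parameters -/

section LinearIndependence

open RingTheory.Sequence

variable {K S M : Type*} [Field K] [CommRing S] [Algebra K S] [AddCommGroup M] [Module S M]
  [Module K M] [IsScalarTower K S M]

/-- If `x` is a nonzerodivisor on `M` and `U ∩ xM = 0`, then the sum of the `xᵏU` is direct. -/
theorem eq_zero_of_sum_pow_smul_eq_zero {x : S} (hx : IsSMulRegular M x) (N : ℕ) (u : ℕ → M)
    (hu : ∀ k m, u k = x • m → u k = 0) (h : ∑ k ∈ Finset.range N, x ^ k • u k = 0) :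
    ∀ k < N, u k = 0 := by
  induction N generalizing u with
  | zero => intro k hk; omega
  | succ N ih =>
    have hs : ∑ k ∈ Finset.range N, x ^ (k + 1) • u (k + 1) =
        x • ∑ k ∈ Finset.range N, x ^ k • u (k + 1) := by
      rw [Finset.smul_sum]
      exact Finset.sum_congr rfl fun k _ => by rw [pow_succ', mul_smul]
    rw [Finset.sum_range_succ', hs, pow_zero, one_smul] at h
    have h0 : u 0 = 0 := hu 0 (-∑ k ∈ Finset.range N, x ^ k • u (k + 1)) (by
      rw [smul_neg]
      exact eq_neg_of_add_eq_zero_right h)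
    rw [h0, add_zero] at h
    have hN := ih (fun k => u (k + 1)) (fun k => hu (k + 1)) (hx.right_eq_zero_of_smul h)
    intro k hk
    cases k with
    | zero => exact h0
    | succ k => exact hN k (by omega)

/-- Lifts to `M` of linearly independent elements of `M / xM` stay linearly independent over the
polynomials in the nonzerodivisor `x`. -/
theorem linearIndependent_pow_smul {κ : Type*} {x : S} (hx : IsSMulRegular M x) {b : κ → M}
    (hb : LinearIndependent K fun i => (Submodule.Quotient.mk (b i) : QuotSMulTop x M)) :
    LinearIndependent K fun p : ℕ × κ => x ^ p.1 • b p.2 := by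
  classical
  rw [linearIndependent_iff'']
  intro s g hg hsum
  let N := s.sup Prod.fst + 1
  let T := s.image Prod.snd
  have hsub : s ⊆ Finset.range N ×ˢ T := fun p hp => by
    rw [Finset.mem_product, Finset.mem_range]
    exact ⟨Nat.lt_succ_of_le (Finset.le_sup (f := Prod.fst) hp), Finset.mem_image_of_mem _ hp⟩
  rw [Finset.sum_subset hsub (fun p _ hp => by rw [hg p hp, zero_smul]),
    Finset.sum_product] at hsum
  have hlin {k : ℕ} {m : M} (h : ∑ i ∈ T, g (k, i) • b i = x • m) : ∀ i ∈ T, g (k, i) = 0 := by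
    refine (linearIndependent_iff'.1 hb) T (fun i => g (k, i)) ?_
    have : (Submodule.Quotient.mk (∑ i ∈ T, g (k, i) • b i) : QuotSMulTop x M) = 0 := by
      rw [Submodule.Quotient.mk_eq_zero, h]
      exact Submodule.smul_mem_pointwise_smul _ _ _ trivial
    rw [← this, ← Submodule.mkQ_apply, map_sum]
    exact Finset.sum_congr rfl fun i _ => rfl
  have hzero := eq_zero_of_sum_pow_smul_eq_zero hx N (fun k => ∑ i ∈ T, g (k, i) • b i)
    (fun k m h => Finset.sum_eq_zero fun i hi => by rw [hlin h i hi, zero_smul]) (by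
      rw [← hsum]
      refine Finset.sum_congr rfl fun k _ => ?_
      rw [Finset.smul_sum]
      exact Finset.sum_congr rfl fun i _ => smul_comm _ _ _)
  rintro ⟨k, i⟩
  by_cases hki : (k, i) ∈ s
  · obtain ⟨hk, hi⟩ := Finset.mem_product.1 (hsub hki)
    exact hlin (m := 0) (by rw [hzero k (Finset.mem_range.1 hk), smul_zero]) i hi
  · exact hg _ hki

/-- If `f` is a weakly regular sequence on `M`, then lifts to `M` of linearly independent elements
of `M / (f)M` stay linearly independent over the polynomials in `f`. -/
theorem linearIndependent_prod_pow_smul {ι : Type*} {n : ℕ} {f : Fin n → S}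
    (hf : IsWeaklyRegular M (List.ofFn f)) {b : ι → M}
    (hb : LinearIndependent K fun i => (Submodule.Quotient.mk (b i) :
      M ⧸ (Ideal.ofList (List.ofFn f) • ⊤ : Submodule S M))) :
    LinearIndependent K fun p : (Fin n → ℕ) × ι => (∏ j, f j ^ p.1 j) • b p.2 := by
  induction n generalizing M with
  | zero =>
    have h : LinearIndependent K b := LinearIndependent.of_comp
      ((Ideal.ofList (List.ofFn f) • ⊤ : Submodule S M).mkQ.restrictScalars K) hb
    have := h.comp (fun p : (Fin 0 → ℕ) × ι => p.2) (fun p p' hp =>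
      Prod.ext (Subsingleton.elim _ _) hp)
    simpa [Function.comp_def] using this
  | succ n ih =>
    rw [List.ofFn_succ] at hf
    obtain ⟨h0, ht⟩ := (isWeaklyRegular_cons_iff _ _ _).1 hf
    let t : Fin n → S := fun j => f j.succ
    have hq : LinearIndependent K fun i => (Submodule.Quotient.mk
        (Submodule.Quotient.mk (b i) : QuotSMulTop (f 0) M) :
        QuotSMulTop (f 0) M ⧸
          (Ideal.ofList (List.ofFn t) • ⊤ : Submodule S (QuotSMulTop (f 0) M))) := by
      rw [List.ofFn_succ] at hb
      exact hb.map' ((Submodule.quotOfListConsSMulTopEquivQuotSMulTopInner M (f 0)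
        (List.ofFn t)).restrictScalars K).toLinearMap
        (LinearEquiv.ker _)
    have hi := linearIndependent_pow_smul h0
      (b := fun p : (Fin n → ℕ) × ι => (∏ j, t j ^ p.1 j) • b p.2) (ih ht hq)
    have := hi.comp (fun p : (Fin (n + 1) → ℕ) × ι => (p.1 0, (fun j => p.1 j.succ, p.2)))
      (fun p p' hp => by
        simp only [Prod.mk.injEq] at hp
        refine Prod.ext (funext fun j => ?_) hp.2.2
        cases j using Fin.cases with
        | zero => exact hp.1
        | succ j => exact congrFun hp.2.1 j)
    simpa [Function.comp_def, Fin.prod_univ_succ, mul_smul, t] using this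

end LinearIndependence

section Generation

open MvPolynomial

variable {K : Type*} [Field K] {n : ℕ}

theorem homogeneousComponent_mul_of_isHomogeneous {p : MvPolynomial (Fin n) K} {d : ℕ}
    (hp : p.IsHomogeneous d) (s : MvPolynomial (Fin n) K) (m : ℕ) :
    homogeneousComponent (m + d) (p * s) = p * homogeneousComponent m s := by
  conv_lhs => rw [← sum_homogeneousComponent s]
  rw [Finset.mul_sum, map_sum]
  have h (k : ℕ) : homogeneousComponent (m + d) (p * homogeneousComponent k s) =
      if k = m then p * homogeneousComponent k s else 0 := by
    rw [homogeneousComponent_of_mem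
      (hp.mul (homogeneousComponent_isHomogeneous k s))]
    exact if_congr (by omega) rfl rfl
  simp only [h]
  rw [Finset.sum_ite_eq']
  split
  · rfl
  · rename_i hm
    rw [homogeneousComponent_eq_zero _ _ (by simpa using hm), mul_zero]

theorem homogeneousComponent_mul_of_lt {p : MvPolynomial (Fin n) K} {d : ℕ}
    (hp : p.IsHomogeneous d) (s : MvPolynomial (Fin n) K) {m : ℕ} (hm : m < d) :
    homogeneousComponent m (p * s) = 0 := by
  conv_lhs => rw [← sum_homogeneousComponent s]
  rw [Finset.mul_sum, map_sum]
  refine Finset.sum_eq_zero fun k _ => ?_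
  rw [homogeneousComponent_of_mem (hp.mul (homogeneousComponent_isHomogeneous k s)),
    if_neg (by omega)]

/-- A graded form of Nakayama's lemma: homogeneous elements that span the polynomial ring modulo
homogeneous `q₁, …, qₙ` of positive degree generate it as a module over `K[q₁, …, qₙ]`. -/
theorem span_prod_pow_mul_eq_top {ι : Type*} {q : Fin n → MvPolynomial (Fin n) K} {d : ℕ}
    (hd : d ≠ 0) (hq : ∀ i, (q i).IsHomogeneous d) {b : ι → MvPolynomial (Fin n) K} {r : ι → ℕ}
    (hb : ∀ i, (b i).IsHomogeneous (r i))
    (hspan : Submodule.span K (Set.range b) ⊔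
      (Ideal.span (Set.range q)).restrictScalars K = ⊤) :
    Submodule.span K (Set.range fun p : (Fin n → ℕ) × ι => (∏ j, q j ^ p.1 j) * b p.2) = ⊤ := by
  classical
  set N := Submodule.span K (Set.range fun p : (Fin n → ℕ) × ι => (∏ j, q j ^ p.1 j) * b p.2)
  have hbN (i : ι) : b i ∈ N := Submodule.subset_span ⟨(0, i), by simp⟩
  have hqN (j : Fin n) {u : MvPolynomial (Fin n) K} (hu : u ∈ N) : q j * u ∈ N := by
    induction hu using Submodule.span_induction with
    | mem u hu =>
      obtain ⟨⟨e, i⟩, rfl⟩ := hu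
      refine Submodule.subset_span ⟨(e + Pi.single j 1, i), ?_⟩
      simp only [Pi.add_apply, pow_add, Finset.prod_mul_distrib, ← mul_assoc]
      rw [mul_comm (q j)]
      congr 2
      rw [Finset.prod_eq_single j]
      · simp
      · intro k _ hk
        simp [hk]
      · simp
    | zero => simp
    | add u v _ _ hu hv => rw [mul_add]; exact N.add_mem hu hv
    | smul c u _ hu => rw [mul_smul_comm]; exact N.smul_mem c hu
  have hcomp (m : ℕ) : ∀ u : MvPolynomial (Fin n) K, homogeneousComponent m u ∈ N := by
    induction m using Nat.strong_induction_on with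
    | _ m ih =>
      intro u
      obtain ⟨v, hv, w, hw, rfl⟩ := Submodule.mem_sup.1 (hspan.ge (Submodule.mem_top (x := u)))
      rw [map_add]
      refine N.add_mem ?_ ?_
      · induction hv using Submodule.span_induction with
        | mem v hv =>
          obtain ⟨i, rfl⟩ := hv
          rw [homogeneousComponent_of_mem (hb i)]
          split
          · exact hbN i
          · exact N.zero_mem
        | zero => simp
        | add u v _ _ hu hv => rw [map_add]; exact N.add_mem hu hv
        | smul c u _ hu => rw [map_smul]; exact N.smul_mem c hu
      · obtain ⟨s, rfl⟩ := Ideal.mem_span_range_iff_exists_fun.1 hw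
        rw [map_sum]
        refine N.sum_mem fun j _ => ?_
        rw [mul_comm]
        rcases lt_or_ge m d with hm | hm
        · rw [homogeneousComponent_mul_of_lt (hq j) _ hm]
          exact N.zero_mem
        · obtain ⟨m, rfl⟩ := Nat.exists_eq_add_of_le' hm
          rw [homogeneousComponent_mul_of_isHomogeneous (hq j)]
          exact hqN j (ih m (by omega) _)
  rw [eq_top_iff]
  rintro u -
  rw [← sum_homogeneousComponent u]
  exact N.sum_mem fun m _ => hcomp m u

theorem finite_quotient_of_X_mem_radical {J : Ideal (MvPolynomial (Fin n) K)}
    (hrad : ∀ j, X j ∈ J.radical) : FiniteDimensional K (MvPolynomial (Fin n) K ⧸ J) := by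
  have hfg := fg_adjoin_of_finite (R := K)
    (Set.finite_range fun j : Fin n => Ideal.Quotient.mk J (X j)) (by
      rintro _ ⟨j, rfl⟩
      obtain ⟨k, hk⟩ := hrad j
      refine IsIntegral.of_pow (n := k + 1) (Nat.succ_pos k) ?_
      rw [pow_succ, ← map_pow, Ideal.Quotient.eq_zero_iff_mem.2 hk, zero_mul]
      exact isIntegral_zero)
  have htop : Algebra.adjoin K (Set.range fun j : Fin n => Ideal.Quotient.mk J (X j)) = ⊤ := by
    rw [← (AlgHom.range_eq_top (Ideal.Quotient.mkₐ K J)).2 (Ideal.Quotient.mkₐ_surjective K J),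
      ← Algebra.map_top, ← adjoin_range_X, AlgHom.map_adjoin, ← Set.range_comp]
    rfl
  rw [htop] at hfg
  exact ⟨hfg⟩

/-- For homogeneous parameters `q` in a polynomial ring, a set `b` of monomials that forms a basis
modulo `q` is a basis over `K[q]`. -/
theorem exists_basis_prod_pow_mul {q : Fin n → MvPolynomial (Fin n) K} {d : ℕ}
    (hd : d ≠ 0) (hq : ∀ i, (q i).IsHomogeneous d)
    (hreg : RingTheory.Sequence.IsWeaklyRegular (MvPolynomial (Fin n) K) (List.ofFn q)) :
    ∃ (ι : Type) (b : ι → MvPolynomial (Fin n) K)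
      (_ : Module.Basis ι K (MvPolynomial (Fin n) K ⧸ Ideal.span (Set.range q)))
      (bS : Module.Basis ((Fin n →₀ ℕ) × ι) K (MvPolynomial (Fin n) K)),
      ∀ p, bS p = (∏ j, q j ^ p.1 j) * b p.2 := by
  set J := Ideal.span (Set.range q)
  let π := (Ideal.Quotient.mkₐ K J).toLinearMap
  obtain ⟨ι, a, -, hspan, hli⟩ := exists_linearIndependent' K
    fun m : Fin n →₀ ℕ => π (monomial m 1)
  let b : ι → MvPolynomial (Fin n) K := fun i => monomial (a i) 1
  have hmon : Submodule.span K (Set.range fun m : Fin n →₀ ℕ =>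
      (monomial m 1 : MvPolynomial (Fin n) K)) = ⊤ := by
    simpa using (basisMonomials (Fin n) K).span_eq
  have hmap : (Submodule.span K (Set.range b)).map π = ⊤ := by
    rw [Submodule.map_span, ← Set.range_comp]
    refine hspan.trans ?_
    change Submodule.span K (Set.range (π ∘ fun m => monomial m 1)) = ⊤
    rw [Set.range_comp, ← Submodule.map_span, hmon, Submodule.map_top]
    exact LinearMap.range_eq_top.2 (Ideal.Quotient.mkₐ_surjective K J)
  have hsup : Submodule.span K (Set.range b) ⊔ J.restrictScalars K = ⊤ := by
    rw [eq_top_iff]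
    rintro u -
    obtain ⟨v, hv, hvu⟩ := hmap.ge (Submodule.mem_top (x := π u))
    rw [← add_sub_cancel v u]
    exact Submodule.add_mem_sup hv (Ideal.Quotient.eq.1 hvu.symm)
  have hJ : (Ideal.ofList (List.ofFn q) • ⊤ :
      Submodule (MvPolynomial (Fin n) K) (MvPolynomial (Fin n) K)) = J := by
    rw [smul_eq_mul, Ideal.mul_top, Ideal.ofList]
    congr 1
    ext p
    simp [List.mem_ofFn]
  have hli' := linearIndependent_prod_pow_smul (K := K) (b := b) hreg (by
    rw [hJ]
    exact hli)
  have htop := span_prod_pow_mul_eq_top hd hq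
    (fun i => isHomogeneous_monomial (1 : K) (rfl : (a i).degree = _)) hsup
  let bS := Module.Basis.mk hli' htop.ge
  refine ⟨ι, b, Module.Basis.mk hli (by rw [← hmap, Submodule.map_span, ← Set.range_comp]; rfl),
    bS.reindex (Equiv.prodCongr Finsupp.equivFunOnFinite (Equiv.refl ι)).symm, fun p => ?_⟩
  simp [bS]

end Generation

section TensorDecomposition

open MvPolynomial TensorProduct

variable {K H A ι : Type*} [Field K] [CommRing H] [Algebra K H] [AddCommGroup A] [Module K A]
  {n : ℕ} {f : Fin n → H} {b : ι → H}

theorem algebraicIndependent_of_linearIndependent [Nonempty ι]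
    (h : LinearIndependent K fun p : (Fin n →₀ ℕ) × ι => (∏ j, f j ^ p.1 j) * b p.2) :
    AlgebraicIndependent K f := by
  obtain ⟨i⟩ := ‹Nonempty ι›
  have hi : LinearIndependent K fun e : Fin n →₀ ℕ => ∏ j, f j ^ e j :=
    LinearIndependent.of_comp (LinearMap.mulRight K (b i))
      (h.comp (fun e => (e, i)) fun e e' h => congrArg Prod.fst h)
  rw [algebraicIndependent_iff_injective_aeval, injective_iff_map_eq_zero]
  intro p hp
  rw [aeval_def, eval₂_eq'] at hp
  ext e
  by_cases he : e ∈ p.support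
  · exact linearIndependent_iff'.1 hi p.support (fun e => p.coeff e)
      (by simpa [Algebra.smul_def] using hp) e he
  · simpa using he

/-- If the products of the monomials in `f` with the `bᵢ` form a basis of `H`, then `H` is
isomorphic to `K[f] ⊗ A` for every space `A` with a basis that has the same index set as `b`. -/
theorem nonempty_linearEquiv_tensorProduct (hf : AlgebraicIndependent K f)
    (bA : Module.Basis ι K A) (bH : Module.Basis ((Fin n →₀ ℕ) × ι) K H)
    (hb : ∀ p, bH p = (∏ j, f j ^ p.1 j) * b p.2) :
    Nonempty (H ≃ₗ[Algebra.adjoin K (Set.range f)] Algebra.adjoin K (Set.range f) ⊗[K] A) := by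
  let P := Algebra.adjoin K (Set.range f)
  let bP : Module.Basis (Fin n →₀ ℕ) K P :=
    (basisMonomials (Fin n) K).map hf.aevalEquiv.toLinearEquiv
  let β : P ⊗[K] A →ₗ[P] H := (bA.constr K b).liftBaseChange P
  have hβ : β.restrictScalars K = ((bP.tensorProduct bA).equiv bH (Equiv.refl _)).toLinearMap := by
    refine (bP.tensorProduct bA).ext fun ⟨e, i⟩ => ?_
    refine Eq.trans ?_ (Module.Basis.equiv_apply _ _ bH (Equiv.refl _)).symm
    simp [β, bP, hb, Subalgebra.smul_def, aeval_monomial, Finsupp.prod_fintype]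
  refine ⟨(LinearEquiv.ofBijective β ?_).symm⟩
  change Function.Bijective (β.restrictScalars K)
  rw [hβ]
  exact LinearEquiv.bijective _

end TensorDecomposition

/-! ### Consequences for the extension -/

section Transport

open MvPolynomial TensorProduct

/-- The consequences, for a polynomial algebra `H`, of `f` being a homogeneous system of
parameters. -/
theorem regular_and_free_of_X_mem_radical {K H : Type*} [Field K] [CommRing H] [Algebra K H]
    {n : ℕ} (Φ : MvPolynomial (Fin n) K ≃ₐ[K] H) {q : Fin n → MvPolynomial (Fin n) K} {d : ℕ}
    (hd : d ≠ 0) (hq : ∀ i, (q i).IsHomogeneous d)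
    (hrad : ∀ j, X j ∈ (Ideal.span (Set.range q)).radical)
    {f : Fin n → H} (hf : ∀ i, f i = Φ (q i)) {I : Ideal H} (hI : I = Ideal.span (Set.range f)) :
    RingTheory.Sequence.IsRegular H (List.ofFn f) ∧
    FiniteDimensional K (H ⧸ I) ∧
    AlgebraicIndependent K f ∧
    Module.Free (Algebra.adjoin K (Set.range f)) H ∧
    Nonempty (H ≃ₗ[Algebra.adjoin K (Set.range f)]
      Algebra.adjoin K (Set.range f) ⊗[K] (H ⧸ I)) := by
  obtain rfl : f = fun i => Φ (q i) := funext hf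
  have hreg := isRegular_of_X_mem_radical hd hq hrad
  have hfin := finite_quotient_of_X_mem_radical hrad
  obtain ⟨ι, b, bA, bS, hbS⟩ := exists_basis_prod_pow_mul hd hq hreg.toIsWeaklyRegular
  have hmap : I = (Ideal.span (Set.range q)).map (Φ : MvPolynomial (Fin n) K →+* H) := by
    rw [hI, Ideal.map_span, ← Set.range_comp]
    rfl
  let e := (Ideal.quotientEquivAlg _ I Φ hmap).toLinearEquiv
  have hne : Nontrivial (MvPolynomial (Fin n) K ⧸ Ideal.span (Set.range q)) := by
    refine Ideal.Quotient.nontrivial_iff.2 fun h => hreg.top_ne_smul ?_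
    rw [smul_eq_mul, Ideal.mul_top, ← h, Ideal.ofList]
    congr 1
    ext p
    simp [List.mem_ofFn]
  have hι : Nonempty ι := bA.index_nonempty
  have hbH (p) : bS.map Φ.toLinearEquiv p = (∏ j, Φ (q j) ^ p.1 j) * Φ (b p.2) := by
    simp [hbS]
  have hind : AlgebraicIndependent K fun i => Φ (q i) :=
    algebraicIndependent_of_linearIndependent (b := fun i => Φ (b i)) (by
      rw [← funext hbH]
      exact (bS.map Φ.toLinearEquiv).linearIndependent)
  obtain ⟨E⟩ := nonempty_linearEquiv_tensorProduct (b := fun i => Φ (b i)) hind (bA.map e)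
    (bS.map Φ.toLinearEquiv) hbH
  refine ⟨?_, Module.Finite.equiv e, hind, Module.Free.of_equiv E.symm, ⟨E⟩⟩
  refine (Φ.toRingEquiv.toAddEquiv.isRegular_congr ?_).1 hreg
  rw [List.forall₂_iff_get]
  refine ⟨by simp, fun i _ _ x => ?_⟩
  simp [smul_eq_mul]

end Transport

theorem mainTheorem6 {V G W : Type*} [AddCommGroup V] [Module (ZMod 2) V] [Group G]
    [AddCommGroup W] [Module (ZMod 2) W] [FiniteDimensional (ZMod 2) W]
    (E : CentralExtension V G W) (hclosed : E.IsBocksteinClosed) (hexact : E.IsTwoPowerExact)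
    {n : ℕ} (hn : Module.finrank (ZMod 2) W = n) (b : Module.Basis (Fin n) (ZMod 2) V) :
    RingTheory.Sequence.IsRegular (ModTwoCohomology W) (List.ofFn (E.kInvariant b)) ∧
    FiniteDimensional (ZMod 2) E.QuotientAlgebra ∧
    AlgebraicIndependent (ZMod 2) (E.kInvariant b) ∧
    Module.Free (Algebra.adjoin (ZMod 2) (Set.range (E.kInvariant b))) (ModTwoCohomology W) ∧
    Nonempty (ModTwoCohomology W
      ≃ₗ[Algebra.adjoin (ZMod 2) (Set.range (E.kInvariant b))]
        TensorProduct (ZMod 2) (Algebra.adjoin (ZMod 2) (Set.range (E.kInvariant b)))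
          E.QuotientAlgebra) := by
  let c := Module.finBasisOfFinrankEq (ZMod 2) W hn
  let Φ := AlgEquiv.ofBijective _ (ModTwoCohomology.isPolynomialOn_coord c).bijective
  choose a ha hQ using fun i => E.exists_component_eq c (b.coord i)
  have hk (i : Fin n) : E.kInvariant b i = Φ (quadPoly (a i)) := ha i
  have hI : E.extensionIdeal = Ideal.span (Set.range (E.kInvariant b)) :=
    E.extensionIdeal_eq_span b
  have hmap : E.extensionIdeal = (Ideal.span (Set.range fun i => quadPoly (a i))).map
      (Φ : MvPolynomial (Fin n) (ZMod 2) →+* ModTwoCohomology W) := by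
    rw [hI, Ideal.map_span, ← Set.range_comp]
    exact congrArg (fun f => Ideal.span (Set.range f)) (funext hk)
  refine regular_and_free_of_X_mem_radical Φ two_ne_zero
    (fun i => isHomogeneous_quadPoly (a i)) (X_mem_radical_span_quadPoly (fun i => ?_) ?_) hk hI
  -- Bockstein closedness, transported to the polynomial ring.
  · have h : Φ (quadDer (a i)) ∈ E.extensionIdeal := by
      change ModTwoCohomology.polyHom _ _ ∈ _
      rw [← ModTwoCohomology.bockstein_quadPoly]
      refine hclosed _ ?_
      rw [hI]
      exact Ideal.subset_span ⟨i, ha i⟩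
    rw [hmap] at h
    obtain ⟨p, hp, hpq⟩ := (Ideal.mem_map_iff_of_surjective _ Φ.surjective).1 h
    rwa [← Φ.injective hpq]
  -- A common zero `w` over `𝔽₂` is a zero of the quadratic map.
  · intro w hw
    have h : E.quadraticMap (c.equivFun.symm w) = 0 := by
      refine b.ext_elem fun i => ?_
      have := hQ i (c.equivFun.symm w)
      rw [Module.Basis.coord_apply] at this
      rw [this, map_zero, Finsupp.zero_apply, ← hw i]
      have hr (j : Fin n) : c.repr (c.equivFun.symm w) j = w j :=
        congrFun (c.equivFun.apply_symm_apply w) j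
      simp only [hr, quadBilin, smul_eq_mul]
    exact (LinearEquiv.map_eq_zero_iff _).1 ((hexact.eq_zero_iff _).1 h)
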